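/- For $g\in\omega^\omega$ let $\Pi_n g(n)=\{h\in\omega^\omega:\forall n\ h(n)<g(n)\}$, and let $I_{ie}(g)$ be the $\sigma$-ideal on $\Pi_n g(n)$ generated by the sets $A_f=\{h\in\Pi_n g(n): h(n)=f(n)\text{ for only finitely many }n\}$, $f\in\Pi_n g(n)$. A set $A\subseteq\Pi_n g(n)$ is $I_{ie}(g)$-positive if $A\notin I_{ie}(g)$. A nonempty tree $T\subseteq\omega^{<\omega}$ is $g$-thick if $t(i)<g(i)$ for all $t\in T$ and $i<|t|$, and for every $t\in T$ there is $n\ge|t|$ such that for every $m<g(n)$ there is $s\in T$ extending $t$ with $s(n)=m$. Write $[T]$ for the set of infinite branches of $T$. (1) For every $g\in\omega^\omega$, every Borel $I_{ie}(g)$-positive set $A\subseteq\Pi_n g(n)$ contains $[T]$ for some $g$-thick tree $T$. (2) (ZF + AD) For every $g\in\omega^\omega$, every $I_{ie}(g)$-positive set $A\subseteq\Pi_n g(n)$ contains $[T]$ for some $g$-thick tree $T$. That is, this statement holds in every model of ZF + AD. (3) Consequently, for every $g\in\omega^\omega$ the $g$-thick trees are dense in $\mathrm{Borel}(\Pi_n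 g(n))/I_{ie}(g)$, the Borel subsets of $\Pi_n g(n)$ ordered by inclusion modulo $I_{ie}(g)$: below every nonzero element there is a nonzero element of the form $[[T]]$ (the class of $[T]$) with $T$ a $g$-thick tree. Moreover, if $g(n)>0$ for all $n$, then for every $g$-thick tree $T$ the set $[T]$ is a Borel $I_{ie}(g)$-positive subset of $\Pi_n g(n)$, so it represents a nonzero element. -/

import Mathlib

universe u

/-! # The ideal `I_ie(g)` and `g`-thick trees on the natural numbers -/

namespace ThickTree

/-- The product `∏ₙ g(n)`, where `g(n) = {0, …, g(n) - 1}`, as a (closed) subset of `ω^ω`. -/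
def prodSpace (g : ℕ → ℕ) : Set (ℕ → ℕ) := {h | ∀ n, h n < g n}

/-- `A_f = {h ∈ ∏ₙ g(n) : h ∩ f is finite}`. -/
def finiteMeet (g f : ℕ → ℕ) : Set (ℕ → ℕ) := {h ∈ prodSpace g | {n | h n = f n}.Finite}

/-- `J` is a σ-ideal of subsets of `X`. -/
structure IsSigmaIdealOn {α : Type*} (X : Set α) (J : Set (Set α)) : Prop where
  subset_space : ∀ B ∈ J, B ⊆ X
  empty_mem : ∅ ∈ J
  mem_of_subset : ∀ B ∈ J, ∀ C, C ⊆ B → C ∈ J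
  iUnion_mem : ∀ F : ℕ → Set α, (∀ k, F k ∈ J) → (⋃ k, F k) ∈ J

/-- `I_ie(g)`: the σ-ideal on `∏ₙ g(n)` generated by the sets `A_f`, `f ∈ ∏ₙ g(n)`. -/
def idealIE (g : ℕ → ℕ) : Set (Set (ℕ → ℕ)) :=
  {A | ∀ J : Set (Set (ℕ → ℕ)), IsSigmaIdealOn (prodSpace g) J →
    (∀ f ∈ prodSpace g, finiteMeet g f ∈ J) → A ∈ J}

/-- A nonempty tree of finite sequences everywhere dominated by `g` such that every node `t` has
some `n` outside its domain for which all values below `g(n)` are taken at `n` by extensions of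
`t` in the tree. -/
structure IsThick (g : ℕ → ℕ) (T : Set (List ℕ)) : Prop where
  nonempty : T.Nonempty
  tree : ∀ t ∈ T, ∀ s, s <+: t → s ∈ T
  dominated : ∀ t ∈ T, ∀ i m, t[i]? = some m → m < g i
  thick : ∀ t ∈ T, ∃ n, t.length ≤ n ∧ ∀ m < g n, ∃ s ∈ T, t <+: s ∧ s[n]? = some m

/-- The set `[T]` of all (infinite) branches of `T`. -/
def branches (T : Set (List ℕ)) : Set (ℕ → ℕ) := {h | ∀ n, (List.range n).map h ∈ T}

/-! ## The forcing `Borel(∏ₙ g(n)) / I_ie(g)` -/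

/-- The Borel subsets of `∏ₙ g(n)`. -/
def BorelSubset (g : ℕ → ℕ) : Type :=
  {B : Set (ℕ → ℕ) // B ⊆ prodSpace g ∧ @MeasurableSet _ (borel (ℕ → ℕ)) B}

theorem empty_mem_idealIE (g : ℕ → ℕ) : ∅ ∈ idealIE g := fun _ hJ _ => hJ.empty_mem

theorem mem_idealIE_of_subset_union {g : ℕ → ℕ} {A B C : Set (ℕ → ℕ)}
    (hA : A ∈ idealIE g) (hB : B ∈ idealIE g) (hC : C ⊆ A ∪ B) : C ∈ idealIE g := by
  intro J hJ hf
  refine hJ.mem_of_subset _ (hJ.iUnion_mem (fun k => if k = 0 then A else B) ?_) C ?_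
  · intro k
    split_ifs
    · exact hA J hJ hf
    · exact hB J hJ hf
  · intro x hx
    rcases hC hx with h | h
    · exact Set.mem_iUnion.2 ⟨0, by simpa using h⟩
    · exact Set.mem_iUnion.2 ⟨1, by simpa using h⟩

/-- Inclusion modulo the ideal. -/
instance (g : ℕ → ℕ) : Preorder (BorelSubset g) where
  le B C := B.1 \ C.1 ∈ idealIE g
  le_refl B := by simpa using empty_mem_idealIE g
  le_trans B C D h₁ h₂ := by
    refine mem_idealIE_of_subset_union h₁ h₂ ?_
    rintro x ⟨hB, hD⟩
    by_cases hC : x ∈ C.1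
    · exact Or.inr ⟨hC, hD⟩
    · exact Or.inl ⟨hB, hC⟩

/-- `Borel(∏ₙ g(n)) / I_ie(g)`: classes of Borel sets that differ by a set in the ideal, ordered
by inclusion modulo the ideal. -/
abbrev BorelMod (g : ℕ → ℕ) : Type := Antisymmetrization (BorelSubset g) (· ≤ ·)

/-- The class of a Borel set. -/
def BorelMod.mk {g : ℕ → ℕ} (B : BorelSubset g) : BorelMod g := toAntisymmetrization (· ≤ ·) B

/-- The zero element, the class of the empty set. The conditions of the forcing are the nonzero
elements. -/
def BorelMod.zero (g : ℕ → ℕ) : BorelMod g :=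
  BorelMod.mk ⟨∅, Set.empty_subset _, @MeasurableSet.empty _ (borel (ℕ → ℕ))⟩

/-- The classes of the sets `[T]` for `g`-thick trees `T`. -/
def thickClasses (g : ℕ → ℕ) : Set (BorelMod g) :=
  {q | ∃ T, IsThick g T ∧ ∃ B : BorelSubset g, B.1 = branches T ∧ BorelMod.mk B = q}

end ThickTree

/-! # Models of `ZF + AD`

Determinacy of all integer games contradicts choice, so its consequences are stated for arbitrary
models `(M, ∈)` of `ZF + AD`. Below, all quantifiers range over the elements of the model, and
all notions (`ω`, functions, finite sequences, σ-ideals, trees) are those of the model. -/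

namespace SetModel

/-- The symbol of the language of set theory. -/
inductive MemSymbol : ℕ → Type
  | mem : MemSymbol 2

/-- The first-order language of set theory. -/
def setLanguage : FirstOrder.Language := ⟨fun _ => Empty, MemSymbol⟩

section

variable {M : Type u} [Membership M M]

instance : setLanguage.Structure M where
  funMap := fun f => Empty.elim f
  RelMap := fun {_} r => match r with
    | .mem => fun v => v 0 ∈ v 1

/-- `x ⊆ y` -/
def Sub (x y : M) : Prop := ∀ z, z ∈ x → z ∈ y

/-- `x = ∅` -/
def IsEmptySet (x : M) : Prop := ∀ z, ¬ z ∈ x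

/-- `p = {x, y}` -/
def IsPair (p x y : M) : Prop := ∀ z, z ∈ p ↔ z = x ∨ z = y

/-- `p = (x, y)`, the Kuratowski ordered pair `{{x}, {x, y}}` -/
def IsOPair (p x y : M) : Prop := ∃ a b, IsPair a x x ∧ IsPair b x y ∧ IsPair p a b

/-- `y = x ∪ {x}` -/
def IsSucc (y x : M) : Prop := ∀ z, z ∈ y ↔ z ∈ x ∨ z = x

/-- `w` contains `∅` and is closed under successor. -/
def IsInductive (w : M) : Prop :=
  (∃ e, e ∈ w ∧ IsEmptySet e) ∧ ∀ x, x ∈ w → ∃ y, y ∈ w ∧ IsSucc y x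

/-- `w = ω` -/
def IsOmega (w : M) : Prop := IsInductive w ∧ ∀ v, IsInductive v → Sub w v

variable (M) in
/-- `(M, ∈)` is a model of Zermelo–Fraenkel set theory (without choice). The two schemata range
over the classes that are first-order definable with parameters from `M`. -/
structure ModelsZF : Prop where
  extensionality : ∀ x y : M, (∀ z : M, z ∈ x ↔ z ∈ y) → x = y
  foundation : ∀ x : M, (∃ y : M, y ∈ x) → ∃ y : M, y ∈ x ∧ ∀ z : M, z ∈ x → ¬ z ∈ y
  pairing : ∀ x y : M, ∃ p, IsPair p x y
  union : ∀ x : M, ∃ u : M, ∀ z : M, z ∈ u ↔ ∃ y : M, y ∈ x ∧ z ∈ y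
  powerset : ∀ x : M, ∃ p : M, ∀ z : M, z ∈ p ↔ Sub z x
  infinity : ∃ w : M, IsInductive w
  separation : ∀ P : Set M, Set.Definable₁ Set.univ setLanguage P →
    ∀ a : M, ∃ b : M, ∀ x : M, x ∈ b ↔ x ∈ a ∧ x ∈ P
  replacement : ∀ F : Set (M × M), Set.Definable₂ Set.univ setLanguage F →
    ∀ a : M, (∀ x : M, x ∈ a → ∃! y : M, (x, y) ∈ F) →
      ∃ b : M, ∀ y : M, y ∈ b ↔ ∃ x : M, x ∈ a ∧ (x, y) ∈ F

/-- `(x, y) ∈ f`; for a function `f` this says `f(x) = y`. -/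
def Maps (f x y : M) : Prop := ∃ p, p ∈ f ∧ IsOPair p x y

/-- `f` is a function from `a` to `b`. -/
def IsFun (f a b : M) : Prop :=
  (∀ p, p ∈ f → ∃ x y, x ∈ a ∧ y ∈ b ∧ IsOPair p x y) ∧ ∀ x, x ∈ a → ∃! y, Maps f x y

/-- `s = f ↾ n` -/
def IsRestr (s f n : M) : Prop := ∀ p, p ∈ s ↔ p ∈ f ∧ ∃ x y, x ∈ n ∧ IsOPair p x y

/-- `t` is a finite sequence of natural numbers (`w = ω`). -/
def IsFinSeq (w t : M) : Prop := ∃ n, n ∈ w ∧ IsFun t n w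

/-! ## The axiom of determinacy -/

/-- `σ` is a function from `ω^{<ω}` to `ω` (`w = ω`). -/
def IsStrategy (w σ : M) : Prop := ∃ S, (∀ t, t ∈ S ↔ IsFinSeq w t) ∧ IsFun σ S w

/-- In the run in which the first player plays `x(0), x(1), …` and the second player
`y(0), y(1), …`, the first player follows `σ`: `x(n) = σ(y ↾ n)` for all `n`. -/
def FirstFollows (w σ x y : M) : Prop :=
  ∀ n, n ∈ w → ∀ s a, IsRestr s y n → Maps x n a → Maps σ s a

/-- In the same run, the second player follows `τ`: `y(n) = τ(x ↾ (n + 1))` for all `n`. -/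
def SecondFollows (w τ x y : M) : Prop :=
  ∀ n k, n ∈ w → IsSucc k n → ∀ s b, IsRestr s x k → Maps y n b → Maps τ s b

variable (M) in
/-- The axiom of determinacy in `M`: in every game in which two players alternate in playing
natural numbers `x(0), y(0), x(1), y(1), …` and the first player wins iff the run `(x, y)` belongs
to a given set `A`, one of the players has a winning strategy. -/
def ModelsAD : Prop :=
  ∀ w : M, IsOmega w → ∀ A : M,
    (∃ σ, IsStrategy w σ ∧
      ∀ x y, IsFun x w w → IsFun y w w → FirstFollows w σ x y → Maps A x y) ∨
    (∃ τ, IsStrategy w τ ∧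
      ∀ x y, IsFun x w w → IsFun y w w → SecondFollows w τ x y → ¬ Maps A x y)

/-! ## The ideal and the trees in the model (`w = ω` throughout) -/

/-- `h ∈ ∏ₙ g(n)` -/
def InProd (w g h : M) : Prop :=
  IsFun h w w ∧ ∀ n a b, n ∈ w → Maps h n a → Maps g n b → a ∈ b

/-- `h ∩ f` is finite: there is `k` such that `h(n) ≠ f(n)` for all `n ∈ ω` with `n ≥ k`. -/
def FiniteMeet (w f h : M) : Prop :=
  ∃ k, k ∈ w ∧ ∀ n, n ∈ w → ¬ n ∈ k → ∀ a, ¬ (Maps h n a ∧ Maps f n a)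

/-- `X = A_f` -/
def IsGenerator (w g f X : M) : Prop := ∀ h, h ∈ X ↔ InProd w g h ∧ FiniteMeet w f h

/-- `J` is a σ-ideal on `∏ₙ g(n)`. -/
structure IsSigmaIdeal (w g J : M) : Prop where
  subset_space : ∀ B, B ∈ J → ∀ h, h ∈ B → InProd w g h
  empty_mem : ∀ e, IsEmptySet e → e ∈ J
  mem_of_subset : ∀ B C, B ∈ J → Sub C B → C ∈ J
  iUnion_mem : ∀ F U, IsFun F w J →
    (∀ h, h ∈ U ↔ ∃ k B, k ∈ w ∧ Maps F k B ∧ h ∈ B) → U ∈ J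

/-- `A` belongs to `I_ie(g)`, the σ-ideal on `∏ₙ g(n)` generated by the sets `A_f`,
`f ∈ ∏ₙ g(n)`. -/
def InIdealIE (w g A : M) : Prop :=
  ∀ J, IsSigmaIdeal w g J → (∀ f X, InProd w g f → IsGenerator w g f X → X ∈ J) → A ∈ J

/-- `T` is a `g`-thick tree. -/
structure IsThick (w g T : M) : Prop where
  finSeq : ∀ t, t ∈ T → IsFinSeq w t
  nonempty : ∃ t, t ∈ T
  tree : ∀ t n s, t ∈ T → n ∈ w → IsRestr s t n → s ∈ T
  dominated : ∀ t n a b, t ∈ T → Maps t n a → Maps g n b → a ∈ b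
  thick : ∀ t, t ∈ T → ∃ n, n ∈ w ∧ (∀ a, ¬ Maps t n a) ∧
    ∀ b m, Maps g n b → m ∈ b → ∃ s, s ∈ T ∧ Sub t s ∧ Maps s n m

/-- `h ∈ [T]` -/
def IsBranch (w T h : M) : Prop := IsFun h w w ∧ ∀ n s, n ∈ w → IsRestr s h n → s ∈ T

end

end SetModel

/-! Both existence results rest on one game. The first player plays pairs `(t_k, n_k)` of a finite
sequence and a position, with `|t_k| ≤ n_k < |t_{k+1}|`. The second player answers each pair with a
value `y(k)`. The first player wins if some `h ∈ A` extends all `t_k` and takes the value `y(k)` at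
`n_k` whenever `y(k) < g(n_k)`.

If the first player has a winning strategy, consider the initial segments of the `h` that arise when
every answer is the value taken. They form a thick tree, because at a late enough challenge `n_k`
the answer can be any `m < g(n_k)` (`exists_thick_of_first`). A branch of this tree dictates its own
answers, and the strategy then produces exactly that branch, which therefore lies in `A`.

If the second player has a winning strategy `τ`, then for each finite list `s` of earlier moves and
each `t`, the answers of `τ` to `(t, n)` form a function `f_{s,t}` of `n` in the product. An `h ∈ A`
meeting all of these infinitely often would let the first player play initial segments of `h` and
beat `τ`. So the countably many sets `A_{f_{s,t}}` cover `A` (`inIdealIE_of_second`). Under AD one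
of the two cases occurs. The argument takes place inside an arbitrary model of ZF, so choices are
replaced by least codes and least moves, and every set formed needs a definability proof.

For Borel `A` no determinacy is needed, since the game can be unfolded. Write `A` as the range of a
continuous `φ` on Baire space, and carry along a finite approximation to a preimage. A positive
piece of `A` can be split over all values at some position into positive pieces with longer
approximations (`exists_splitting`). Iterating this gives the tree, and continuity of `φ` puts its
branches in `A` (`exists_thick_subset_range`).

Conversely, if `g > 0`, a branch of a thick tree can be built that meets countably many given
functions infinitely often, so `[T]` is positive (`IsThick.branches_notMem_idealIE`). Density
follows from these two facts. -/

namespace SetModel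

open FirstOrder Set

/-! ### First-order definability with parameters, closed under logical operations -/

section Definability

variable {M : Type u} [Membership M M]

/-- A predicate on assignments that is first-order definable with parameters. -/
class DefPred (P : (ℕ → M) → Prop) : Prop where
  out : Set.Definable (Set.univ : Set M) setLanguage {v : ℕ → M | P v}

/-- A function on assignments whose graph is first-order definable with parameters. -/
class DefFun (t : (ℕ → M) → M) : Prop where
  out : DefPred fun v : ℕ → M => v 0 = t fun n => v (n + 1)

theorem DefPred.congr {P Q : (ℕ → M) → Prop} (h : DefPred P) (e : ∀ v, P v ↔ Q v) :
    DefPred Q := by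
  have : P = Q := funext fun v => propext (e v)
  exact this ▸ h

theorem DefPred.relabel {P : (ℕ → M) → Prop} (h : DefPred P) (f : ℕ → ℕ) :
    DefPred fun v => P fun n => v (f n) :=
  ⟨h.out.preimage_comp f⟩

instance DefPred.and {P Q : (ℕ → M) → Prop} [hP : DefPred P] [hQ : DefPred Q] :
    DefPred fun v => P v ∧ Q v := ⟨hP.out.inter hQ.out⟩

instance DefPred.or {P Q : (ℕ → M) → Prop} [hP : DefPred P] [hQ : DefPred Q] :
    DefPred fun v => P v ∨ Q v := ⟨hP.out.union hQ.out⟩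

instance DefPred.not {P : (ℕ → M) → Prop} [hP : DefPred P] :
    DefPred fun v => ¬ P v := ⟨hP.out.compl⟩

instance DefPred.imp {P Q : (ℕ → M) → Prop} [hP : DefPred P] [hQ : DefPred Q] :
    DefPred fun v => P v → Q v :=
  (inferInstance : DefPred fun v => ¬ P v ∨ Q v).congr fun _ => imp_iff_not_or.symm

instance DefPred.iff {P Q : (ℕ → M) → Prop} [hP : DefPred P] [hQ : DefPred Q] :
    DefPred fun v => P v ↔ Q v :=
  (inferInstance : DefPred fun v => (P v → Q v) ∧ (Q v → P v)).congr fun _ =>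
    (iff_iff_implies_and_implies).symm

/-- A condition independent of the assignment defines everything or nothing, so it may be any
proposition at all, definable or not. -/
instance (priority := low) DefPred.const {p : Prop} : DefPred fun _ : ℕ → M => p := by
  by_cases hp : p
  · exact ⟨by simp [hp]⟩
  · exact ⟨by simp [hp]⟩

/-- De Bruijn convention, used throughout: the bound variable becomes `v 0` and the free variables
move up by one. -/
instance DefPred.ex {P : (ℕ → M) → M → Prop}
    [h : DefPred fun v : ℕ → M => P (fun n => v (n + 1)) (v 0)] :
    DefPred fun v => ∃ y, P v y := by
  obtain ⟨φ, hφ⟩ := h.out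
  refine ⟨⟨Language.Formula.iExs (L := setLanguage[[(univ : Set M)]]) (α := ℕ) (β := Fin 1)
    (φ.relabel fun n : ℕ => n.casesOn (Sum.inr 0) Sum.inl), ?_⟩⟩
  ext v
  have key : ∀ w : ℕ → M, φ.Realize w ↔ P (fun n => w (n + 1)) (w 0) := fun w =>
    (Set.ext_iff.1 hφ w).symm
  simp only [Set.mem_ofPred_eq, Language.Formula.realize_iExs, Language.Formula.realize_relabel, key]
  constructor
  · rintro ⟨y, hy⟩
    exact ⟨fun _ => y, hy⟩
  · rintro ⟨i, hi⟩
    exact ⟨i 0, hi⟩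

instance DefPred.all {P : (ℕ → M) → M → Prop}
    [h : DefPred fun v : ℕ → M => P (fun n => v (n + 1)) (v 0)] :
    DefPred fun v => ∀ y, P v y :=
  (inferInstance : DefPred fun v => ¬ ∃ y, ¬ P v y).congr fun _ => by simp

instance DefPred.existsUnique {P : (ℕ → M) → M → Prop}
    [h' : DefPred fun v : ℕ → M => ∃ y, P v y ∧ ∀ z, P v z → z = y] :
    DefPred fun v => ∃! y, P v y := h'

theorem DefPred.var_mem (i j : ℕ) : DefPred fun v : ℕ → M => v i ∈ v j := by
  have h : Set.Definable (∅ : Set M) setLanguage {v : ℕ → M | v i ∈ v j} := by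
    refine Set.empty_definable_iff.2 ⟨Language.Relations.formula₂ (L := setLanguage)
      MemSymbol.mem (Language.Term.var i) (Language.Term.var j), ?_⟩
    ext v
    rfl
  exact ⟨h.mono (Set.empty_subset _)⟩

theorem DefPred.var_eq (i j : ℕ) : DefPred fun v : ℕ → M => v i = v j := by
  have h : Set.Definable (∅ : Set M) setLanguage {v : ℕ → M | v i = v j} := by
    refine Set.empty_definable_iff.2 ⟨Language.Term.equal (L := setLanguage)
      (Language.Term.var i) (Language.Term.var j), ?_⟩
    ext v
    simp [Language.Formula.realize_equal]
  exact ⟨h.mono (Set.empty_subset _)⟩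

theorem DefPred.var_eq_const (i : ℕ) (c : M) : DefPred fun v : ℕ → M => v i = c := by
  refine ⟨⟨Language.Term.equal (Language.Term.var i)
    (Language.Constants.term (setLanguage.con (⟨c, mem_univ c⟩ : (univ : Set M)))), ?_⟩⟩
  ext v
  simp [Language.Formula.realize_equal]

instance DefFun.var (i : ℕ) : DefFun fun v : ℕ → M => v i := ⟨DefPred.var_eq 0 (i + 1)⟩

instance DefFun.const (c : M) : DefFun fun _ : ℕ → M => c := ⟨DefPred.var_eq_const 0 c⟩

/-- Substitution of a definable function for the variable `0`. -/
theorem DefPred.subst {P : (ℕ → M) → M → Prop} {t : (ℕ → M) → M}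
    (h : DefPred fun v : ℕ → M => P (fun n => v (n + 1)) (v 0)) (ht : DefFun t) :
    DefPred fun v => P v (t v) := by
  have h1 := ht.out
  have : DefPred fun v : ℕ → M => ∃ y, y = t v ∧ P v y := inferInstance
  exact this.congr fun v => by simp

theorem DefPred.comp₁ {P : M → Prop} (h : DefPred fun v : ℕ → M => P (v 0))
    {s : (ℕ → M) → M} (hs : DefFun s) : DefPred fun v => P (s v) :=
  DefPred.subst (P := fun _ x => P x) h hs

theorem DefFun.weaken {t : (ℕ → M) → M} (ht : DefFun t) :
    DefFun fun v : ℕ → M => t fun n => v (n + 1) :=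
  ⟨ht.out.relabel fun n => n.casesOn 0 fun k => k + 2⟩

theorem DefPred.comp₂ {P : M → M → Prop} (h : DefPred fun v : ℕ → M => P (v 0) (v 1))
    {s t : (ℕ → M) → M} (hs : DefFun s) (ht : DefFun t) : DefPred fun v => P (s v) (t v) := by
  refine DefPred.subst (P := fun v x => P x (t v)) ?_ hs
  refine DefPred.subst (P := fun v x => P (v 0) x) ?_ ht.weaken
  exact h.relabel fun n => n.casesOn 1 fun _ => 0

instance DefPred.mem {s t : (ℕ → M) → M} [hs : DefFun s] [ht : DefFun t] :
    DefPred fun v => s v ∈ t v :=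
  DefPred.comp₂ (P := fun a b => a ∈ b) (DefPred.var_mem 0 1) hs ht

instance DefPred.eq {s t : (ℕ → M) → M} [hs : DefFun s] [ht : DefFun t] :
    DefPred fun v => s v = t v :=
  DefPred.comp₂ (P := fun a b => a = b) (DefPred.var_eq 0 1) hs ht

open Classical in
/-- Definition by cases. -/
noncomputable def cases (p : Prop) (a b : M) : M := if p then a else b

omit [Membership M M] in
theorem cases_pos {p : Prop} {a b : M} (h : p) : cases p a b = a := if_pos h

omit [Membership M M] in
theorem cases_neg {p : Prop} {a b : M} (h : ¬ p) : cases p a b = b := if_neg h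

instance DefFun.cases {P : (ℕ → M) → Prop} {s t : (ℕ → M) → M}
    [hs : DefFun s] [ht : DefFun t] [hP : DefPred P] :
    DefFun fun v => cases (P v) (s v) (t v) := by
  have h1 := hs.out
  have h2 := ht.out
  have h3 : DefPred fun v : ℕ → M => P fun n => v (n + 1) := hP.relabel fun n => n + 1
  have : DefPred fun v : ℕ → M => (P (fun n => v (n + 1)) ∧ v 0 = s fun n => v (n + 1)) ∨
    (¬ P (fun n => v (n + 1)) ∧ v 0 = t fun n => v (n + 1)) := inferInstance
  refine ⟨this.congr fun v => ?_⟩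
  by_cases h : P fun n => v (n + 1)
  · simp [h, cases_pos]
  · simp [h, cases_neg]

theorem DefFun.relabel {t : (ℕ → M) → M} (ht : DefFun t) (f : ℕ → ℕ) :
    DefFun fun v : ℕ → M => t fun n => v (f n) :=
  ⟨ht.out.relabel fun n => n.casesOn 0 fun k => f k + 1⟩

theorem DefPred.comp₃ {P : M → M → M → Prop} (h : DefPred fun v : ℕ → M => P (v 0) (v 1) (v 2))
    {s t u : (ℕ → M) → M} (hs : DefFun s) (ht : DefFun t) (hu : DefFun u) :
    DefPred fun v => P (s v) (t v) (u v) := by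
  refine DefPred.subst (P := fun v x => P x (t v) (u v)) ?_ hs
  refine DefPred.subst (P := fun v x => P (v 0) x (u fun n => v (n + 1))) ?_ ht.weaken
  refine DefPred.subst (P := fun v x => P (v 1) (v 0) x) ?_ hu.weaken.weaken
  exact h.relabel fun n => n.casesOn 2 fun n => n.casesOn 1 fun _ => 0

theorem DefFun.comp₁ {F : M → M} (h : DefFun fun v : ℕ → M => F (v 0))
    {s : (ℕ → M) → M} (hs : DefFun s) : DefFun fun v => F (s v) :=
  ⟨DefPred.comp₂ (P := fun a b => a = F b) h.out (DefFun.var 0) hs.weaken⟩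

theorem DefFun.comp₂ {F : M → M → M} (h : DefFun fun v : ℕ → M => F (v 0) (v 1))
    {s t : (ℕ → M) → M} (hs : DefFun s) (ht : DefFun t) : DefFun fun v => F (s v) (t v) :=
  ⟨DefPred.comp₃ (P := fun a b c => a = F b c) h.out (DefFun.var 0) hs.weaken ht.weaken⟩

instance DefPred.sub {x y : (ℕ → M) → M} [hx : DefFun x] [hy : DefFun y] :
    DefPred fun v => Sub (x v) (y v) :=
  DefPred.comp₂ (by unfold Sub; infer_instance) hx hy

instance DefPred.isEmptySet {x : (ℕ → M) → M} [hx : DefFun x] :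
    DefPred fun v => IsEmptySet (x v) :=
  DefPred.comp₁ (by unfold IsEmptySet; infer_instance) hx

instance DefPred.isPair {p x y : (ℕ → M) → M} [hp : DefFun p] [hx : DefFun x] [hy : DefFun y] :
    DefPred fun v => IsPair (p v) (x v) (y v) :=
  DefPred.comp₃ (by unfold IsPair; infer_instance) hp hx hy

instance DefPred.isOPair {p x y : (ℕ → M) → M} [hp : DefFun p] [hx : DefFun x] [hy : DefFun y] :
    DefPred fun v => IsOPair (p v) (x v) (y v) :=
  DefPred.comp₃ (by unfold IsOPair; infer_instance) hp hx hy

instance DefPred.isSucc {x y : (ℕ → M) → M} [hx : DefFun x] [hy : DefFun y] :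
    DefPred fun v => IsSucc (x v) (y v) :=
  DefPred.comp₂ (by unfold IsSucc; infer_instance) hx hy

instance DefPred.isInductive {x : (ℕ → M) → M} [hx : DefFun x] :
    DefPred fun v => IsInductive (x v) :=
  DefPred.comp₁ (by unfold IsInductive; infer_instance) hx

instance DefPred.maps {f x y : (ℕ → M) → M} [hf : DefFun f] [hx : DefFun x] [hy : DefFun y] :
    DefPred fun v => Maps (f v) (x v) (y v) :=
  DefPred.comp₃ (by unfold Maps; infer_instance) hf hx hy

instance DefPred.isFun {f a b : (ℕ → M) → M} [hf : DefFun f] [ha : DefFun a] [hb : DefFun b] :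
    DefPred fun v => IsFun (f v) (a v) (b v) :=
  DefPred.comp₃ (by unfold IsFun; infer_instance) hf ha hb

instance DefPred.finiteMeet {w f h : (ℕ → M) → M} [hw : DefFun w] [hf : DefFun f]
    [hh : DefFun h] : DefPred fun v => FiniteMeet (w v) (f v) (h v) :=
  DefPred.comp₃ (by unfold FiniteMeet; infer_instance) hw hf hh

instance DefPred.inProd {w g h : (ℕ → M) → M} [hw : DefFun w] [hg : DefFun g]
    [hh : DefFun h] : DefPred fun v => InProd (w v) (g v) (h v) :=
  DefPred.comp₃ (by unfold InProd; infer_instance) hw hg hh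

end Definability

/-! ### Elementary set theory in a model of `ZF` -/

/-- `M` is a model of `ZF`. -/
class ZF (M : Type u) [Membership M M] : Prop where
  out : ModelsZF M

section Basic

variable {M : Type u} [Membership M M] [ZF M]

instance (priority := low) ZF.nonempty : Nonempty M := (ZF.out (M := M)).infinity.nonempty

theorem ext_iff {x y : M} : x = y ↔ ∀ z : M, z ∈ x ↔ z ∈ y :=
  ⟨fun h _ => h ▸ Iff.rfl, ZF.out.extensionality x y⟩

theorem set_ext {x y : M} (h : ∀ z : M, z ∈ x ↔ z ∈ y) : x = y := ext_iff.2 h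

open Classical in
/-- The unique object satisfying `P`, or a default value. -/
noncomputable def iota (P : M → Prop) : M :=
  if h : ∃! x, P x then h.choose else Classical.arbitrary M

theorem iota_spec {P : M → Prop} (h : ∃! x, P x) : P (iota P) := by
  rw [iota, dif_pos h]; exact h.choose_spec.1

theorem iota_eq {P : M → Prop} {x : M} (hx : P x) (h : ∀ y, P y → y = x) : iota P = x :=
  h _ (iota_spec ⟨x, hx, h⟩)

/-- A definite description whose object is the set of elements with a property. -/
theorem mem_iota {Q : M → Prop} (h : ∃ b : M, ∀ x, x ∈ b ↔ Q x) {x : M} :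
    x ∈ iota (fun b : M => ∀ x, x ∈ b ↔ Q x) ↔ Q x := by
  obtain ⟨b, hb⟩ := h
  exact iota_spec (P := fun b : M => ∀ x, x ∈ b ↔ Q x)
    ⟨b, hb, fun c hc => set_ext fun z => (hc z).trans (hb z).symm⟩ x

/-- The graph splits into two definable cases, according to whether the description is proper. The
default value is an element of `M` and so is available as a parameter. -/
instance DefFun.iota {P : (ℕ → M) → M → Prop}
    [h : DefPred fun v : ℕ → M => P (fun n => v (n + 1)) (v 0)] :
    DefFun fun v => SetModel.iota (P v) := by
  have h1 : DefPred fun v : ℕ → M => P (fun n => v (n + 2)) (v 0) :=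
    h.relabel fun n => n.casesOn 0 fun k => k + 2
  have h2 : DefPred fun v : ℕ → M => P (fun n => v (n + 3)) (v 0) :=
    h.relabel fun n => n.casesOn 0 fun k => k + 3
  have h3 : DefPred fun v : ℕ → M => ∃! y, P (fun n => v (n + 1)) y := by
    have h4 : DefPred fun v : ℕ → M => P (fun n => v (n + 1 + 1)) (v 0) := h1
    have h5 : DefPred fun v : ℕ → M => P (fun n => v (n + 1 + 1 + 1)) (v 0) := h2
    infer_instance
  have : DefPred fun v : ℕ → M => (P (fun n => v (n + 1)) (v 0) ∧ ∃! y, P (fun n => v (n + 1)) y) ∨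
    ((¬ ∃! y, P (fun n => v (n + 1)) y) ∧ v 0 = Classical.arbitrary M) := inferInstance
  refine ⟨this.congr fun v => ?_⟩
  by_cases hu : ∃! y, P (fun n => v (n + 1)) y
  · simp only [hu, and_true, not_true, false_and, or_false]
    exact ⟨fun h => hu.unique h (iota_spec hu), fun h => h ▸ iota_spec hu⟩
  · simp only [hu, and_false, not_false_eq_true, true_and, false_or]
    rw [SetModel.iota, dif_neg hu]

theorem exists_sep {P : M → Prop} (h : DefPred fun v : ℕ → M => P (v 0)) (a : M) :
    ∃ b : M, ∀ x, x ∈ b ↔ x ∈ a ∧ P x :=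
  ZF.out.separation {x | P x} (h.out.preimage_comp (β := Fin 1) fun _ => 0) a

/-- `{x ∈ a | P x}` -/
noncomputable def sep (a : M) (P : M → Prop) : M := iota fun b => ∀ x, x ∈ b ↔ x ∈ a ∧ P x

theorem mem_sep {P : M → Prop} [h : DefPred fun v : ℕ → M => P (v 0)] {a x : M} :
    x ∈ sep a P ↔ x ∈ a ∧ P x := mem_iota (exists_sep h a)

instance DefFun.sep {a : (ℕ → M) → M} {P : (ℕ → M) → M → Prop} [ha : DefFun a]
    [h : DefPred fun v : ℕ → M => P (fun n => v (n + 1)) (v 0)] :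
    DefFun fun v => SetModel.sep (a v) (P v) := by
  unfold SetModel.sep
  have h1 : DefPred fun v : ℕ → M => P (fun n => v (n + 1 + 1)) (v 0) :=
    h.relabel fun n => n.casesOn 0 fun k => k + 2
  have h2 : DefFun fun v : ℕ → M => a (fun n => v (n + 1 + 1)) := ha.relabel _
  infer_instance

/-- `{x, y}` -/
noncomputable def pair (x y : M) : M := iota fun p => IsPair p x y

theorem isPair_pair (x y : M) : IsPair (pair x y) x y := by
  obtain ⟨p, hp⟩ := ZF.out.pairing x y
  exact iota_spec (P := fun p => IsPair p x y)
    ⟨p, hp, fun q hq => set_ext fun z => (hq z).trans (hp z).symm⟩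

theorem mem_pair {x y z : M} : z ∈ pair x y ↔ z = x ∨ z = y := isPair_pair x y z

theorem isPair_iff {p x y : M} : IsPair p x y ↔ p = pair x y :=
  ⟨fun h => set_ext fun z => (h z).trans mem_pair.symm, fun h => h ▸ isPair_pair x y⟩

/-- `(x, y)` -/
noncomputable def opair (x y : M) : M := pair (pair x x) (pair x y)

theorem isOPair_iff {p x y : M} : IsOPair p x y ↔ p = opair x y := by
  simp [IsOPair, isPair_iff, opair]

theorem pair_inj_right {x y z : M} (h : pair x y = pair x z) : y = z := by
  have h1 : y = x ∨ y = z := mem_pair.1 (h ▸ mem_pair.2 (Or.inr rfl))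
  have h2 : z = x ∨ z = y := mem_pair.1 (h ▸ mem_pair.2 (Or.inr rfl))
  grind

theorem opair_inj {x y x' y' : M} : opair x y = opair x' y' ↔ x = x' ∧ y = y' := by
  refine ⟨fun h => ?_, fun ⟨h, h'⟩ => h ▸ h' ▸ rfl⟩
  have hx : x = x' := by
    have h1 : pair x x ∈ opair x' y' := h ▸ mem_pair.2 (Or.inl rfl)
    have h2 : x' ∈ pair x x := by
      rcases mem_pair.1 h1 with h | h <;> rw [h] <;> exact mem_pair.2 (Or.inl rfl)
    simpa [mem_pair, eq_comm] using h2
  subst hx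
  exact ⟨rfl, pair_inj_right (pair_inj_right h)⟩

instance DefFun.pair {x y : (ℕ → M) → M} [hx : DefFun x] [hy : DefFun y] :
    DefFun fun v => SetModel.pair (x v) (y v) :=
  DefFun.comp₂ (by unfold SetModel.pair; infer_instance) hx hy

instance DefFun.opair {x y : (ℕ → M) → M} [hx : DefFun x] [hy : DefFun y] :
    DefFun fun v => SetModel.opair (x v) (y v) := by
  unfold SetModel.opair; infer_instance

theorem maps_iff {f x y : M} : Maps f x y ↔ opair x y ∈ f := by
  simp [Maps, isOPair_iff]

/-- `∅` -/
noncomputable def emp : M := iota fun e => ∀ x, x ∈ e ↔ False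

theorem notMem_emp {x : M} : x ∉ (emp : M) := by
  have h : ∃ b : M, ∀ x, x ∈ b ↔ False := by
    obtain ⟨b, hb⟩ := exists_sep (M := M) (P := fun _ => False) inferInstance (Classical.arbitrary M)
    exact ⟨b, fun x => by simp [hb]⟩
  exact (mem_iota h).1

theorem isEmptySet_iff {x : M} : IsEmptySet x ↔ x = emp :=
  ⟨fun h => set_ext fun z => iff_of_false (h z) notMem_emp, fun h => h ▸ fun _ => notMem_emp⟩

theorem eq_emp_or_nonempty (x : M) : x = emp ∨ ∃ y, y ∈ x := by
  by_cases h : ∃ y, y ∈ x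
  · exact Or.inr h
  · exact Or.inl (isEmptySet_iff.1 fun z hz => h ⟨z, hz⟩)

/-- `x ∪ y` -/
noncomputable def cup (x y : M) : M := iota fun u => ∀ z, z ∈ u ↔ z ∈ x ∨ z ∈ y

theorem mem_cup {x y z : M} : z ∈ cup x y ↔ z ∈ x ∨ z ∈ y := by
  obtain ⟨u, hu⟩ := ZF.out.union (pair x y)
  exact mem_iota ⟨u, fun z => by simp [hu, mem_pair]⟩

instance DefFun.cup {x y : (ℕ → M) → M} [hx : DefFun x] [hy : DefFun y] :
    DefFun fun v => SetModel.cup (x v) (y v) :=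
  DefFun.comp₂ (by unfold SetModel.cup; infer_instance) hx hy

/-- the power set -/
noncomputable def pow (x : M) : M := iota fun u => ∀ z, z ∈ u ↔ Sub z x

theorem mem_pow {x z : M} : z ∈ pow x ↔ Sub z x := mem_iota (ZF.out.powerset x)

instance DefFun.pow {x : (ℕ → M) → M} [hx : DefFun x] :
    DefFun fun v => SetModel.pow (x v) :=
  DefFun.comp₁ (by unfold SetModel.pow; infer_instance) hx

/-- `x × y` -/
noncomputable def cart (x y : M) : M :=
  sep (pow (pow (cup x y))) fun p => ∃ a b, a ∈ x ∧ b ∈ y ∧ p = opair a b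

theorem mem_cart {x y p : M} : p ∈ cart x y ↔ ∃ a b, a ∈ x ∧ b ∈ y ∧ p = opair a b := by
  rw [cart, mem_sep, and_iff_right_iff_imp]
  rintro ⟨a, b, ha, hb, rfl⟩
  refine mem_pow.2 fun z hz => mem_pow.2 fun c hc => mem_cup.2 ?_
  rcases mem_pair.1 hz with rfl | rfl <;> rcases mem_pair.1 hc with rfl | rfl <;> simp [*]

theorem opair_mem_cart {x y a b : M} : opair a b ∈ cart x y ↔ a ∈ x ∧ b ∈ y := by
  rw [mem_cart]
  constructor
  · rintro ⟨c, d, hc, hd, h⟩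
    obtain ⟨rfl, rfl⟩ := opair_inj.1 h
    exact ⟨hc, hd⟩
  · exact fun h => ⟨a, b, h.1, h.2, rfl⟩

instance DefFun.cart {x y : (ℕ → M) → M} [hx : DefFun x] [hy : DefFun y] :
    DefFun fun v => SetModel.cart (x v) (y v) :=
  DefFun.comp₂ (by unfold SetModel.cart; infer_instance) hx hy

theorem mem_irrefl (x : M) : x ∉ x := by
  intro h
  obtain ⟨y, hy, hy'⟩ := ZF.out.foundation (pair x x) ⟨x, mem_pair.2 (Or.inl rfl)⟩
  have : y = x := by simpa [mem_pair] using hy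
  subst this
  exact hy' y hy h

theorem mem_asymm {x y : M} (h : x ∈ y) : y ∉ x := by
  intro h'
  obtain ⟨z, hz, hz'⟩ := ZF.out.foundation (pair x y) ⟨x, mem_pair.2 (Or.inl rfl)⟩
  rcases mem_pair.1 hz with rfl | rfl
  · exact hz' y (mem_pair.2 (Or.inr rfl)) h'
  · exact hz' x (mem_pair.2 (Or.inl rfl)) h

/-- `x ∪ {x}` -/
noncomputable def succ (x : M) : M := cup x (pair x x)

theorem mem_succ {x z : M} : z ∈ succ x ↔ z ∈ x ∨ z = x := by simp [succ, mem_cup, mem_pair]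

theorem self_mem_succ {x : M} : x ∈ succ x := mem_succ.2 (Or.inr rfl)

theorem mem_succ_of_mem {x z : M} (h : z ∈ x) : z ∈ succ x := mem_succ.2 (Or.inl h)

theorem isSucc_iff {y x : M} : IsSucc y x ↔ y = succ x :=
  ⟨fun h => set_ext fun z => (h z).trans mem_succ.symm, fun h => h ▸ fun _ => mem_succ⟩

instance DefFun.succ {x : (ℕ → M) → M} [hx : DefFun x] :
    DefFun fun v => SetModel.succ (x v) := by
  unfold SetModel.succ; infer_instance

theorem succ_inj {x y : M} : succ x = succ y ↔ x = y := by
  refine ⟨fun h => ?_, fun h => h ▸ rfl⟩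
  have h1 : x ∈ succ y := h ▸ self_mem_succ
  have h2 : y ∈ succ x := h ▸ self_mem_succ
  rcases mem_succ.1 h1 with h1 | h1
  · rcases mem_succ.1 h2 with h2 | h2
    · exact absurd h2 (mem_asymm h1)
    · exact h2.symm
  · exact h1

theorem succ_ne_emp {x : M} : succ x ≠ emp := fun h => notMem_emp (h ▸ self_mem_succ : x ∈ emp)

/-- the predecessor of a successor -/
noncomputable def pred (x : M) : M := iota fun y => x = succ y

theorem pred_succ {x : M} : pred (succ x) = x :=
  iota_eq (P := fun y => succ x = succ y) rfl fun _ h => (succ_inj.1 h).symm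

instance DefFun.pred {x : (ℕ → M) → M} [hx : DefFun x] :
    DefFun fun v => SetModel.pred (x v) :=
  DefFun.comp₁ (by unfold SetModel.pred; infer_instance) hx

end Basic
end SetModel

namespace SetModel

/-! ### Functions, restrictions and function spaces in the model -/

section Functions

variable {M : Type u} [Membership M M] [ZF M]

/-- `f(x)` -/
noncomputable def app (f x : M) : M := iota fun y => opair x y ∈ f

instance DefFun.app {x y : (ℕ → M) → M} [hx : DefFun x] [hy : DefFun y] :
    DefFun fun v => SetModel.app (x v) (y v) :=
  DefFun.comp₂ (by unfold SetModel.app; infer_instance) hx hy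

theorem IsFun.opair_mem_iff {f a b x y : M} (hf : IsFun f a b) :
    opair x y ∈ f ↔ x ∈ a ∧ app f x = y := by
  have h1 : ∀ x ∈ a, ∀ y, opair x y ∈ f → app f x = y := fun x hx y hy =>
    (hf.2 x hx).unique (maps_iff.2 (iota_spec (by simpa only [maps_iff] using hf.2 x hx)))
      (maps_iff.2 hy)
  constructor
  · intro h
    obtain ⟨x', y', hx', hy', e⟩ := hf.1 _ h
    obtain ⟨rfl, rfl⟩ := opair_inj.1 (isOPair_iff.1 e)
    exact ⟨hx', h1 x hx' y h⟩
  · rintro ⟨hx, rfl⟩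
    exact iota_spec (P := fun y => opair x y ∈ f) (by simpa only [maps_iff] using hf.2 x hx)

theorem IsFun.maps_iff {f a b x y : M} (hf : IsFun f a b) :
    Maps f x y ↔ x ∈ a ∧ app f x = y := SetModel.maps_iff.trans hf.opair_mem_iff

theorem IsFun.app_mem {f a b x : M} (hf : IsFun f a b) (hx : x ∈ a) : app f x ∈ b := by
  obtain ⟨x', y', hx', hy', e⟩ := hf.1 _ (hf.opair_mem_iff.2 ⟨hx, rfl⟩)
  obtain ⟨rfl, rfl⟩ := opair_inj.1 (isOPair_iff.1 e)
  exact hy'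

theorem IsFun.sub {f a b : M} (hf : IsFun f a b) : Sub f (cart a b) := by
  intro p hp
  obtain ⟨x, y, hx, hy, e⟩ := hf.1 p hp
  exact mem_cart.2 ⟨x, y, hx, hy, isOPair_iff.1 e⟩

theorem IsFun.sub_of_app_eq {f g a b c d : M} (hf : IsFun f a b) (hg : IsFun g c d)
    (hac : Sub a c) (h : ∀ x ∈ a, app f x = app g x) : Sub f g := by
  intro p hp
  obtain ⟨x, y, hx, hy, rfl⟩ := mem_cart.1 (hf.sub p hp)
  rw [hg.opair_mem_iff, ← h x hx]
  exact ⟨hac x hx, (hf.opair_mem_iff.1 hp).2⟩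

theorem IsFun.ext {f g a b c : M} (hf : IsFun f a b) (hg : IsFun g a c)
    (h : ∀ x ∈ a, app f x = app g x) : f = g :=
  set_ext fun p => ⟨hf.sub_of_app_eq hg (fun _ => id) h p,
    hg.sub_of_app_eq hf (fun _ => id) (fun x hx => (h x hx).symm) p⟩

theorem IsFun.of_opair {f a b : M} (h : Sub f (cart a b)) (h' : ∀ x ∈ a, ∃! y, opair x y ∈ f) :
    IsFun f a b := by
  refine ⟨fun p hp => ?_, fun x hx => by simpa only [SetModel.maps_iff] using h' x hx⟩
  obtain ⟨x, y, hx, hy, rfl⟩ := mem_cart.1 (h p hp)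
  exact ⟨x, y, hx, hy, isOPair_iff.2 rfl⟩

/-- the function `x ↦ t x` from `a` to `b` -/
noncomputable def lam (a b : M) (t : M → M) : M :=
  sep (cart a b) fun p => ∃ x, p = opair x (t x)

instance DefFun.lam {a b : (ℕ → M) → M} {t : (ℕ → M) → M → M} [ha : DefFun a] [hb : DefFun b]
    [h : DefFun fun v : ℕ → M => t (fun n => v (n + 1)) (v 0)] :
    DefFun fun v => SetModel.lam (a v) (b v) (t v) := by
  unfold SetModel.lam
  have h1 : DefFun fun v : ℕ → M => t (fun n => v (n + 1 + 1)) (v 0) :=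
    h.relabel fun n => n.casesOn 0 fun k => k + 2
  infer_instance

theorem isFun_lam {a b : M} {t : M → M} [DefFun fun v : ℕ → M => t (v 0)]
    (h : ∀ x ∈ a, t x ∈ b) : IsFun (lam a b t) a b := by
  refine .of_opair (fun p hp => (mem_sep.1 hp).1) fun x hx =>
    ⟨t x, mem_sep.2 ⟨opair_mem_cart.2 ⟨hx, h x hx⟩, x, rfl⟩, fun y hy => ?_⟩
  obtain ⟨x', e⟩ := (mem_sep.1 hy).2
  obtain ⟨rfl, rfl⟩ := opair_inj.1 e
  rfl

theorem app_lam {a b x : M} {t : M → M} [DefFun fun v : ℕ → M => t (v 0)]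
    (h : ∀ x ∈ a, t x ∈ b) (hx : x ∈ a) : app (lam a b t) x = t x :=
  ((isFun_lam h).opair_mem_iff.1 (mem_sep.2 ⟨opair_mem_cart.2 ⟨hx, h x hx⟩, x, rfl⟩)).2

/-- `f ↾ n` -/
noncomputable def restr (f n : M) : M := sep f fun p => ∃ x y, x ∈ n ∧ p = opair x y

instance DefFun.restr {x y : (ℕ → M) → M} [hx : DefFun x] [hy : DefFun y] :
    DefFun fun v => SetModel.restr (x v) (y v) :=
  DefFun.comp₂ (by unfold SetModel.restr; infer_instance) hx hy

theorem isRestr_iff {s f n : M} : IsRestr s f n ↔ s = restr f n := by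
  rw [ext_iff]
  simp only [IsRestr, isOPair_iff, restr, mem_sep]

theorem opair_mem_restr {f n x y : M} : opair x y ∈ restr f n ↔ opair x y ∈ f ∧ x ∈ n := by
  rw [restr, mem_sep]
  refine and_congr_right fun _ => ⟨?_, fun h => ⟨x, y, h, rfl⟩⟩
  rintro ⟨x', y', h, e⟩
  exact (opair_inj.1 e).1 ▸ h

theorem app_restr {f n x : M} (hx : x ∈ n) : app (restr f n) x = app f x := by
  simp only [app, opair_mem_restr, hx, and_true]

theorem IsFun.restr {f a b n : M} (hf : IsFun f a b) (hn : Sub n a) :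
    IsFun (restr f n) n b := by
  refine .of_opair (fun p hp => ?_) fun x hx => ?_
  · obtain ⟨hp', x, y, hx, rfl⟩ := mem_sep.1 hp
    exact opair_mem_cart.2 ⟨hx, (opair_mem_cart.1 (hf.sub _ hp')).2⟩
  · simp only [opair_mem_restr, hx, and_true, hf.opair_mem_iff, hn x hx, true_and]
    exact ⟨_, rfl, fun _ h => h.symm⟩

theorem restr_sub (f n : M) : Sub (restr f n) f := fun _ hp => (mem_sep.1 hp).1

theorem restr_restr {f n m : M} (h : Sub n m) :
    SetModel.restr (SetModel.restr f m) n = SetModel.restr f n := by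
  refine set_ext fun p => ?_
  simp only [SetModel.restr, mem_sep]
  constructor
  · rintro ⟨⟨hp, _⟩, h⟩
    exact ⟨hp, h⟩
  · rintro ⟨hp, x, y, hx, rfl⟩
    exact ⟨⟨hp, x, y, h x hx, rfl⟩, x, y, hx, rfl⟩

theorem IsFun.restr_eq_self {f n m b : M} (hf : IsFun f n b) (h : Sub n m) :
    SetModel.restr f m = f := by
  refine set_ext fun p => ⟨restr_sub f m p, fun hp => ?_⟩
  obtain ⟨x, y, hx, hy, rfl⟩ := mem_cart.1 (hf.sub p hp)
  exact opair_mem_restr.2 ⟨hp, h x hx⟩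

theorem IsFun.restr_congr {f f' n a a' b b' : M} (hf : IsFun f a b) (hf' : IsFun f' a' b')
    (ha : Sub n a) (ha' : Sub n a') (h : ∀ x ∈ n, app f x = app f' x) :
    SetModel.restr f n = SetModel.restr f' n :=
  (hf.restr ha).ext (hf'.restr ha') fun x hx => by rw [app_restr hx, app_restr hx, h x hx]

/-- the domain of `f` -/
noncomputable def dom (f : M) : M := iota fun d => ∀ x, x ∈ d ↔ ∃ y, opair x y ∈ f

instance DefFun.dom {x : (ℕ → M) → M} [hx : DefFun x] :
    DefFun fun v => SetModel.dom (x v) :=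
  DefFun.comp₁ (by unfold SetModel.dom; infer_instance) hx

theorem IsFun.dom_eq {f a b : M} (hf : IsFun f a b) : dom f = a := by
  have h : ∃ d : M, ∀ x, x ∈ d ↔ ∃ y, opair x y ∈ f :=
    ⟨a, fun x => by simp [hf.opair_mem_iff]⟩
  refine set_ext fun x => (mem_iota h).trans ?_
  simp [hf.opair_mem_iff]

/-- the set of functions from `a` to `b` -/
noncomputable def funSpace (a b : M) : M := sep (pow (cart a b)) fun f => IsFun f a b

theorem mem_funSpace {a b f : M} : f ∈ funSpace a b ↔ IsFun f a b := by
  rw [funSpace, mem_sep, and_iff_right_iff_imp]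
  exact fun h => mem_pow.2 h.sub

end Functions

/-! ### The natural numbers of the model, with `∈` as `<` and `Sub` as `≤` -/

section Omega

variable {M : Type u} [Membership M M] [ZF M]

variable (M) in
/-- `ω` -/
noncomputable def omega : M := iota fun w => IsOmega w

theorem isOmega_omega : IsOmega (omega M) := by
  obtain ⟨w, hw⟩ := ZF.out (M := M) |>.infinity
  obtain ⟨u, hu⟩ := exists_sep (M := M) (P := fun x => ∀ v : M, IsInductive v → x ∈ v) inferInstance w
  refine iota_spec (P := fun w : M => IsOmega w) ⟨u, ⟨⟨?_, fun x hx => ?_⟩, fun v hv x hx => ?_⟩,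
    fun v hv => ?_⟩
  · refine ⟨emp, (hu _).2 ?_, isEmptySet_iff.2 rfl⟩
    have : ∀ v : M, IsInductive v → emp ∈ v := fun v ⟨⟨e, he, h⟩, _⟩ => isEmptySet_iff.1 h ▸ he
    exact ⟨this w hw, this⟩
  · refine ⟨succ x, (hu _).2 ?_, isSucc_iff.2 rfl⟩
    have : ∀ v : M, IsInductive v → succ x ∈ v := fun v hv => by
      obtain ⟨y, hy, h⟩ := hv.2 x (((hu x).1 hx).2 v hv)
      exact isSucc_iff.1 h ▸ hy
    exact ⟨this w hw, this⟩
  · exact ((hu x).1 hx).2 v hv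
  · refine set_ext fun x => ⟨fun hx => (hu x).2 ⟨hv.2 w hw x hx, fun z hz => hv.2 z hz x hx⟩,
      fun hx => ((hu x).1 hx).2 v hv.1⟩

theorem isOmega_iff {w : M} : IsOmega w ↔ w = omega M := by
  refine ⟨fun h => set_ext fun x => ?_, fun h => h ▸ isOmega_omega⟩
  exact ⟨h.2 _ isOmega_omega.1 x, isOmega_omega.2 _ h.1 x⟩

theorem emp_mem_omega : emp ∈ omega M := by
  obtain ⟨e, he, h⟩ := (isOmega_omega (M := M)).1.1
  exact isEmptySet_iff.1 h ▸ he

theorem succ_mem_omega {n : M} (h : n ∈ omega M) : succ n ∈ omega M := by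
  obtain ⟨y, hy, h⟩ := (isOmega_omega (M := M)).1.2 n h
  exact isSucc_iff.1 h ▸ hy

theorem omega_induction {P : M → Prop} [DefPred fun v : ℕ → M => P (v 0)] (h0 : P emp)
    (hs : ∀ n ∈ omega M, P n → P (succ n)) (n : M) (hn : n ∈ omega M) : P n := by
  have : IsInductive (sep (omega M) P) := by
    refine ⟨⟨emp, mem_sep.2 ⟨emp_mem_omega, h0⟩, isEmptySet_iff.2 rfl⟩, fun x hx => ?_⟩
    obtain ⟨hx, h⟩ := mem_sep.1 hx
    exact ⟨succ x, mem_sep.2 ⟨succ_mem_omega hx, hs x hx h⟩, isSucc_iff.2 rfl⟩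
  exact (mem_sep.1 (isOmega_omega.2 _ this n hn)).2

theorem exists_minimal {P : M → Prop} [DefPred fun v : ℕ → M => P (v 0)] {a x : M} (hx : x ∈ a)
    (h : P x) : ∃ m, m ∈ a ∧ P m ∧ ∀ k ∈ m, k ∈ a → ¬ P k := by
  obtain ⟨m, hm, h⟩ := ZF.out.foundation (sep a P) ⟨x, mem_sep.2 ⟨hx, h⟩⟩
  exact ⟨m, (mem_sep.1 hm).1, (mem_sep.1 hm).2, fun k hk hka hP => h k (mem_sep.2 ⟨hka, hP⟩) hk⟩

theorem mem_omega_of_mem {n : M} (hn : n ∈ omega M) : ∀ {m : M}, m ∈ n → m ∈ omega M := by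
  refine fun {m} => omega_induction (P := fun n => ∀ m, m ∈ n → m ∈ omega M)
    (fun m hm => (notMem_emp hm).elim) (fun n hn ih m hm => ?_) n hn m
  rcases mem_succ.1 hm with h | rfl
  exacts [ih m h, hn]

theorem sub_omega {n : M} (hn : n ∈ omega M) : Sub n (omega M) := fun _ => mem_omega_of_mem hn

theorem sub_of_mem {n m : M} (hn : n ∈ omega M) : m ∈ n → Sub m n := by
  refine omega_induction (P := fun n => ∀ m, m ∈ n → Sub m n)
    (fun m hm => (notMem_emp hm).elim) (fun n hn ih m hm k hk => mem_succ.2 (Or.inl ?_)) n hn m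
  rcases mem_succ.1 hm with h | rfl
  exacts [ih m h k hk, hk]

theorem omega_strong_induction {P : M → Prop} [DefPred fun v : ℕ → M => P (v 0)]
    (h : ∀ n ∈ omega M, (∀ m ∈ n, P m) → P n) (n : M) (hn : n ∈ omega M) : P n := by
  by_contra hP
  obtain ⟨m, hm, hPm, hmin⟩ := exists_minimal (P := fun n => ¬ P n) hn hP
  exact hPm (h m hm fun k hk => not_not.1 (hmin k hk (mem_omega_of_mem hm hk)))

theorem emp_mem_or_eq {n : M} (hn : n ∈ omega M) : n = emp ∨ emp ∈ n := by
  refine omega_induction (P := fun n => n = emp ∨ emp ∈ n) (Or.inl rfl)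
    (fun n _ ih => Or.inr (mem_succ.2 ?_)) n hn
  rcases ih with rfl | h
  exacts [Or.inr rfl, Or.inl h]

theorem eq_emp_or_succ {n : M} (hn : n ∈ omega M) : n = emp ∨ ∃ m ∈ omega M, n = succ m :=
  omega_induction (P := fun n => n = emp ∨ ∃ m, m ∈ omega M ∧ n = succ m) (Or.inl rfl)
    (fun n hn _ => Or.inr ⟨n, hn, rfl⟩) n hn

theorem succ_mem_or_eq {n m : M} (hn : n ∈ omega M) : m ∈ n → succ m ∈ n ∨ succ m = n := by
  refine omega_induction (P := fun n => ∀ m, m ∈ n → succ m ∈ n ∨ succ m = n)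
    (fun m hm => (notMem_emp hm).elim) (fun n hn ih m hm => ?_) n hn m
  rcases mem_succ.1 hm with h | rfl
  · exact Or.inl (mem_succ.2 (ih m h))
  · exact Or.inr rfl

theorem omega_trichotomy {n m : M} (hn : n ∈ omega M) (hm : m ∈ omega M) :
    m ∈ n ∨ m = n ∨ n ∈ m := by
  refine omega_induction (P := fun n => m ∈ n ∨ m = n ∨ n ∈ m)
    (Or.inr (emp_mem_or_eq hm)) (fun n hn ih => ?_) n hn
  rw [mem_succ]
  rcases ih with h | h | h
  · exact Or.inl (Or.inl h)
  · exact Or.inl (Or.inr h)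
  · exact Or.inr ((succ_mem_or_eq hm h).symm.imp Eq.symm id)

theorem sub_of_notMem {n m : M} (hn : n ∈ omega M) (hm : m ∈ omega M) (h : n ∉ m) : Sub m n := by
  rcases omega_trichotomy hn hm with h' | rfl | h'
  exacts [sub_of_mem hn h', fun _ => id, absurd h' h]

theorem notMem_of_sub {n m : M} (h : Sub m n) : n ∉ m := fun h' => mem_irrefl n (h n h')

theorem sub_succ {n : M} : Sub n (succ n) := fun _ => mem_succ_of_mem

theorem succ_mem_succ {n m : M} (hn : n ∈ omega M) (h : m ∈ n) : succ m ∈ succ n :=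
  mem_succ.2 (succ_mem_or_eq hn h)

/-- the least element of `ω` with a property -/
noncomputable def least (P : M → Prop) : M := iota fun m => m ∈ omega M ∧ P m ∧ ∀ k ∈ m, ¬ P k

instance DefFun.least {P : (ℕ → M) → M → Prop}
    [h : DefPred fun v : ℕ → M => P (fun n => v (n + 1)) (v 0)] :
    DefFun fun v => SetModel.least (P v) := by
  unfold SetModel.least
  have h1 : DefPred fun v : ℕ → M => P (fun n => v (n + 1 + 1)) (v 0) :=
    h.relabel fun n => n.casesOn 0 fun k => k + 2
  infer_instance

theorem least_spec {P : M → Prop} [DefPred fun v : ℕ → M => P (v 0)]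
    (h : ∃ n, n ∈ omega M ∧ P n) : least P ∈ omega M ∧ P (least P) := by
  obtain ⟨n, hn, h⟩ := h
  obtain ⟨m, hm, hPm, hmin⟩ := exists_minimal hn h
  have hmin' : ∀ k ∈ m, ¬ P k := fun k hk => hmin k hk (mem_omega_of_mem hm hk)
  have := iota_spec (P := fun m => m ∈ omega M ∧ P m ∧ ∀ k ∈ m, ¬ P k)
    ⟨m, ⟨hm, hPm, hmin'⟩, fun k hk => ?_⟩
  · exact ⟨this.1, this.2.1⟩
  · rcases omega_trichotomy hm hk.1 with h' | h' | h'
    · exact absurd hk.2.1 (hmin' k h')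
    · exact h'
    · exact absurd hPm (hk.2.2 m h')

end Omega

/-! ### Finite sequences and recursion on `ω` -/

section Sequences

variable {M : Type u} [Membership M M] [ZF M]

/-- the finite sequences of elements of `S` -/
noncomputable def seqs (S : M) : M :=
  sep (pow (cart (omega M) S)) fun s => ∃ n, n ∈ omega M ∧ IsFun s n S

theorem mem_seqs {S s : M} : s ∈ seqs S ↔ ∃ n, n ∈ omega M ∧ IsFun s n S := by
  rw [seqs, mem_sep, and_iff_right_iff_imp]
  rintro ⟨n, hn, h⟩
  refine mem_pow.2 fun p hp => ?_
  obtain ⟨x, y, hx, hy, rfl⟩ := mem_cart.1 (h.sub p hp)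
  exact opair_mem_cart.2 ⟨mem_omega_of_mem hn hx, hy⟩

theorem mem_seqs_iff {S s : M} : s ∈ seqs S ↔ dom s ∈ omega M ∧ IsFun s (dom s) S := by
  rw [mem_seqs]
  exact ⟨fun ⟨n, hn, h⟩ => h.dom_eq.symm ▸ ⟨hn, h⟩, fun h => ⟨_, h⟩⟩

theorem dom_mem_omega {S s : M} (h : s ∈ seqs S) : dom s ∈ omega M := (mem_seqs_iff.1 h).1

theorem isFun_of_mem_seqs {S s : M} (h : s ∈ seqs S) : IsFun s (dom s) S := (mem_seqs_iff.1 h).2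

theorem isFun_emp (S : M) : IsFun emp emp S :=
  ⟨fun _ h => (notMem_emp h).elim, fun _ h => (notMem_emp h).elim⟩

theorem emp_mem_seqs (S : M) : emp ∈ seqs S := mem_seqs.2 ⟨emp, emp_mem_omega, isFun_emp S⟩

/-- `s ⌢ a` -/
noncomputable def snoc (s a : M) : M := cup s (pair (opair (dom s) a) (opair (dom s) a))

instance DefFun.snoc {x y : (ℕ → M) → M} [hx : DefFun x] [hy : DefFun y] :
    DefFun fun v => SetModel.snoc (x v) (y v) := by
  unfold SetModel.snoc; infer_instance

theorem opair_mem_snoc {s a x y : M} :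
    opair x y ∈ snoc s a ↔ opair x y ∈ s ∨ x = dom s ∧ y = a := by
  simp [snoc, mem_cup, mem_pair, opair_inj]

theorem isFun_snoc {s a n S : M} (hs : IsFun s n S) (ha : a ∈ S) :
    IsFun (snoc s a) (succ n) S := by
  refine .of_opair (fun p hp => ?_) fun x hx => ?_
  · simp only [snoc, mem_cup, mem_pair, or_self] at hp
    rcases hp with hp | rfl
    · obtain ⟨x, y, hx, hy, rfl⟩ := mem_cart.1 (hs.sub p hp)
      exact opair_mem_cart.2 ⟨mem_succ_of_mem hx, hy⟩
    · exact opair_mem_cart.2 ⟨hs.dom_eq.symm ▸ self_mem_succ, ha⟩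
  · simp only [opair_mem_snoc, hs.opair_mem_iff, hs.dom_eq]
    rcases mem_succ.1 hx with h | rfl
    · have : x ≠ n := fun e => mem_irrefl n (e ▸ h)
      simp [h, this]
    · simp [mem_irrefl x]

theorem app_snoc_self {s a n S : M} (hs : IsFun s n S) (ha : a ∈ S) : app (snoc s a) n = a :=
  ((isFun_snoc hs ha).opair_mem_iff.1 (opair_mem_snoc.2 (Or.inr ⟨hs.dom_eq.symm, rfl⟩))).2

theorem app_snoc_of_mem {s a n S x : M} (hs : IsFun s n S) (ha : a ∈ S) (hx : x ∈ n) :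
    app (snoc s a) x = app s x :=
  ((isFun_snoc hs ha).opair_mem_iff.1
    (opair_mem_snoc.2 (Or.inl (hs.opair_mem_iff.2 ⟨hx, rfl⟩)))).2

theorem restr_snoc {s a n S : M} (hs : IsFun s n S) (ha : a ∈ S) : restr (snoc s a) n = s :=
  ((isFun_snoc hs ha).restr sub_succ).ext hs fun x hx => by
    rw [app_restr hx, app_snoc_of_mem hs ha hx]

theorem restr_succ {f a S n : M} (hf : IsFun f a S) (hn : Sub (succ n) a) :
    restr f (succ n) = snoc (restr f n) (app f n) := by
  have h1 : IsFun (restr f n) n S := hf.restr fun x hx => hn x (sub_succ x hx)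
  have h2 : app f n ∈ S := hf.app_mem (hn _ self_mem_succ)
  refine (hf.restr hn).ext (isFun_snoc h1 h2) fun x hx => ?_
  rw [app_restr hx]
  rcases mem_succ.1 hx with h | rfl
  · rw [app_snoc_of_mem h1 h2 h, app_restr h]
  · rw [app_snoc_self h1 h2]

theorem snoc_mem_seqs {s a S : M} (hs : s ∈ seqs S) (ha : a ∈ S) : snoc s a ∈ seqs S :=
  mem_seqs.2 ⟨_, succ_mem_omega (dom_mem_omega hs), isFun_snoc (isFun_of_mem_seqs hs) ha⟩

theorem IsFun.restr_mem_seqs {f S n : M} (hf : IsFun f (omega M) S) (hn : n ∈ omega M) :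
    SetModel.restr f n ∈ seqs S := mem_seqs.2 ⟨n, hn, hf.restr (sub_omega hn)⟩

theorem restr_emp (f : M) : restr f emp = emp :=
  set_ext fun _ => iff_of_false
    (fun h => let ⟨_, _, hx, _⟩ := (mem_sep.1 h).2; notMem_emp hx) notMem_emp

/-- Course-of-values recursion on `ω`. -/
theorem exists_recursion (S : M) (G : M → M) [DefFun fun v : ℕ → M => G (v 0)]
    (hG : ∀ s ∈ seqs S, G s ∈ S) :
    ∃ x, IsFun x (omega M) S ∧ ∀ n ∈ omega M, app x n = G (restr x n) := by
  have hG' : ∀ {t : (ℕ → M) → M}, DefFun t → DefFun fun v => G (t v) := fun ht =>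
    DefFun.comp₁ inferInstance ht
  have inst : ∀ (s t : (ℕ → M) → M) [DefFun s] [DefFun t],
      DefPred fun v => app (s v) (t v) = G (restr (s v) (t v)) := fun s t _ _ =>
    DefPred.comp₂ (P := fun a b => a = b) inferInstance inferInstance (hG' inferInstance)
  -- `A s n`: the sequence `s` is an attempt of length `n`, that is, it obeys the recursion as far
  -- as it goes.
  set A : M → M → Prop := fun s n => IsFun s n S ∧ ∀ i ∈ n, app s i = G (restr s i) with hA
  have uniq : ∀ {s s' n n'}, n ∈ omega M → n' ∈ omega M → A s n → A s' n' → ∀ i ∈ omega M,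
      i ∈ n → i ∈ n' → app s i = app s' i := by
    intro s s' n n' hn hn' hs hs'
    refine omega_strong_induction fun i hi ih h h' => ?_
    rw [hs.2 i h, hs'.2 i h']
    congr 1
    exact hs.1.restr_congr hs'.1 (sub_of_mem hn h) (sub_of_mem hn' h') fun j hj =>
      ih j hj (sub_of_mem hn h j hj) (sub_of_mem hn' h' j hj)
  have ex : ∀ n ∈ omega M, ∃ s, A s n := by
    refine omega_induction ⟨emp, isFun_emp S, fun i hi => (notMem_emp hi).elim⟩ ?_
    rintro n hn ⟨s, hs, h⟩
    have ha : G s ∈ S := hG s (mem_seqs.2 ⟨n, hn, hs⟩)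
    refine ⟨snoc s (G s), isFun_snoc hs ha, fun i hi => ?_⟩
    rcases mem_succ.1 hi with hi | rfl
    · rw [app_snoc_of_mem hs ha hi, h i hi]
      congr 1
      exact hs.restr_congr (isFun_snoc hs ha) (sub_of_mem hn hi)
        (fun x hx => sub_succ x (sub_of_mem hn hi x hx)) fun x hx =>
          (app_snoc_of_mem hs ha (sub_of_mem hn hi x hx)).symm
    · rw [app_snoc_self hs ha, restr_snoc hs ha]
  -- By `uniq` all attempts of length `n + 1` give the same value at `n`, so a definite description
  -- suffices and no attempt has to be chosen.
  set t : M → M := fun n => iota fun a => ∃ s, A s (succ n) ∧ a = app s n with ht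
  have ht' : ∀ {s n}, n ∈ omega M → A s (succ n) → t n = app s n := fun {s n} hn hs =>
    iota_eq ⟨s, hs, rfl⟩ fun a ⟨s', hs', e⟩ => e ▸ uniq (succ_mem_omega hn) (succ_mem_omega hn)
      hs' hs n hn self_mem_succ self_mem_succ
  have htd : DefFun fun v : ℕ → M => t (v 0) := by simp only [ht, hA]; infer_instance
  have htS : ∀ n ∈ omega M, t n ∈ S := fun n hn => by
    obtain ⟨s, hs⟩ := ex (succ n) (succ_mem_omega hn)
    exact ht' hn hs ▸ hs.1.app_mem self_mem_succ
  refine ⟨lam (omega M) S t, isFun_lam htS, fun n hn => ?_⟩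
  obtain ⟨s, hs⟩ := ex (succ n) (succ_mem_omega hn)
  rw [app_lam htS hn, ht' hn hs, hs.2 n self_mem_succ]
  congr 1
  refine hs.1.restr_congr (isFun_lam htS) sub_succ (sub_omega hn) fun i hi => ?_
  have hi' := mem_omega_of_mem hn hi
  obtain ⟨s', hs'⟩ := ex (succ i) (succ_mem_omega hi')
  rw [app_lam htS hi', ht' hi' hs']
  exact uniq (succ_mem_omega hn) (succ_mem_omega hi') hs hs' i hi' (mem_succ_of_mem hi)
    self_mem_succ

end Sequences
end SetModel

namespace SetModel

/-! ### Enumerations of `ω × ω` and `ω^{<ω} × ω` -/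

section Enumeration

variable {M : Type u} [Membership M M] [ZF M]

/-- Simple recursion is the course-of-values recursion that looks only at the last entry of the
history, whose index is the predecessor of its length. -/
theorem exists_iterate {S s₀ : M} (F : M → M) [DefFun fun v : ℕ → M => F (v 0)] (h₀ : s₀ ∈ S)
    (hF : ∀ s ∈ S, F s ∈ S) :
    ∃ r, IsFun r (omega M) S ∧ app r emp = s₀ ∧ ∀ n ∈ omega M, app r (succ n) = F (app r n) := by
  have hd : DefFun fun v : ℕ → M => F (app (v 0) (pred (dom (v 0)))) :=
    DefFun.comp₁ (F := F) inferInstance inferInstance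
  obtain ⟨r, hr, h⟩ := exists_recursion S
    (fun s => cases (dom s = emp) s₀ (F (app s (pred (dom s))))) fun s hs => by
      by_cases h : dom s = emp
      · rw [cases_pos h]
        exact h₀
      · rw [cases_neg h]
        rcases eq_emp_or_succ (dom_mem_omega hs) with h' | ⟨m, hm, h'⟩
        · exact absurd h' h
        · refine hF _ ((isFun_of_mem_seqs hs).app_mem ?_)
          rw [h', pred_succ]
          exact self_mem_succ
  refine ⟨r, hr, ?_, fun n hn => ?_⟩
  · rw [h emp emp_mem_omega, restr_emp, (isFun_emp S).dom_eq, cases_pos rfl]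
  · have hn' := succ_mem_omega hn
    rw [h _ hn', (hr.restr (sub_omega hn')).dom_eq, cases_neg succ_ne_emp, pred_succ,
      app_restr self_mem_succ]

/-- the first coordinate of an ordered pair -/
noncomputable def fst (p : M) : M := iota fun x => ∃ y, p = opair x y

/-- the second coordinate of an ordered pair -/
noncomputable def snd (p : M) : M := iota fun y => ∃ x, p = opair x y

instance DefFun.fst {x : (ℕ → M) → M} [hx : DefFun x] :
    DefFun fun v => SetModel.fst (x v) :=
  DefFun.comp₁ (by unfold SetModel.fst; infer_instance) hx

instance DefFun.snd {x : (ℕ → M) → M} [hx : DefFun x] :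
    DefFun fun v => SetModel.snd (x v) :=
  DefFun.comp₁ (by unfold SetModel.snd; infer_instance) hx

@[simp] theorem fst_opair (x y : M) : fst (opair x y) = x :=
  iota_eq (P := fun x' => ∃ y', opair x y = opair x' y') ⟨y, rfl⟩
    fun _ ⟨_, h⟩ => (opair_inj.1 h).1.symm

@[simp] theorem snd_opair (x y : M) : snd (opair x y) = y :=
  iota_eq (P := fun y' => ∃ x', opair x y = opair x' y') ⟨x, rfl⟩
    fun _ ⟨_, h⟩ => (opair_inj.1 h).2.symm

/-- A step of the walk through the triples `(a, b, d)` that runs down each antidiagonal. -/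
noncomputable def walkStep (p : M) : M :=
  cases (fst p = emp) (opair (succ (snd (snd p))) (opair emp (succ (snd (snd p)))))
    (opair (pred (fst p)) (opair (succ (fst (snd p))) (snd (snd p))))

instance DefFun.walkStep {x : (ℕ → M) → M} [hx : DefFun x] :
    DefFun fun v => SetModel.walkStep (x v) := by
  unfold SetModel.walkStep; infer_instance

theorem walkStep_emp (b d : M) :
    walkStep (opair emp (opair b d)) = opair (succ d) (opair emp (succ d)) := by
  simp [walkStep, cases_pos]

theorem walkStep_succ (a b d : M) :
    walkStep (opair (succ a) (opair b d)) = opair a (opair (succ b) d) := by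
  simp [walkStep, cases_neg, succ_ne_emp, pred_succ]

variable (M) in
/-- Functions `P₁`, `P₂` on `ω` such that `n ↦ (P₁(n), P₂(n))` is onto `ω × ω`, `P₁(n) ≤ n`. -/
theorem exists_pairing : ∃ P₁ P₂ : M, IsFun P₁ (omega M) (omega M) ∧ IsFun P₂ (omega M) (omega M) ∧
    (∀ c ∈ omega M, app P₁ c ∈ succ c) ∧
    ∀ a ∈ omega M, ∀ b ∈ omega M, ∃ c, c ∈ omega M ∧ app P₁ c = a ∧ app P₂ c = b := by
  obtain ⟨r, hr, hr0, hrs⟩ := exists_iterate (S := cart (omega M) (cart (omega M) (omega M)))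
    (s₀ := opair emp (opair emp emp)) walkStep
    (opair_mem_cart.2 ⟨emp_mem_omega, opair_mem_cart.2 ⟨emp_mem_omega, emp_mem_omega⟩⟩)
    (fun s hs => by
      obtain ⟨a, q, ha, hq, rfl⟩ := mem_cart.1 hs
      obtain ⟨b, d, hb, hd, rfl⟩ := mem_cart.1 hq
      rcases eq_emp_or_succ ha with rfl | ⟨a', ha', rfl⟩
      · rw [walkStep_emp]
        exact opair_mem_cart.2 ⟨succ_mem_omega hd, opair_mem_cart.2
          ⟨emp_mem_omega, succ_mem_omega hd⟩⟩
      · rw [walkStep_succ]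
        exact opair_mem_cart.2 ⟨ha', opair_mem_cart.2 ⟨succ_mem_omega hb, hd⟩⟩)
  have form : ∀ n ∈ omega M, ∃ a b d, a ∈ omega M ∧ b ∈ omega M ∧ d ∈ omega M ∧
      app r n = opair a (opair b d) := fun n hn => by
    obtain ⟨a, q, ha, hq, e⟩ := mem_cart.1 (hr.app_mem hn)
    obtain ⟨b, d, hb, hd, rfl⟩ := mem_cart.1 hq
    exact ⟨a, b, d, ha, hb, hd, e⟩
  -- The third coordinate `d` records the antidiagonal. The invariant `a ≤ d ≤ n` yields `P₁(n) ≤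
  -- n`, which later lets the enumeration of finite sequences refer back to its own earlier terms.
  have bound : ∀ n ∈ omega M, ∃ a b d, a ∈ omega M ∧ b ∈ omega M ∧ d ∈ omega M ∧
      app r n = opair a (opair b d) ∧ a ∈ succ d ∧ d ∈ succ n := by
    refine omega_induction ⟨emp, emp, emp, emp_mem_omega, emp_mem_omega, emp_mem_omega, hr0,
      self_mem_succ, self_mem_succ⟩ ?_
    rintro n hn ⟨a, b, d, ha, hb, hd, e, h1, h2⟩
    rw [hrs n hn, e]
    rcases eq_emp_or_succ ha with rfl | ⟨a', ha', rfl⟩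
    · rw [walkStep_emp]
      exact ⟨_, _, _, succ_mem_omega hd, emp_mem_omega, succ_mem_omega hd, rfl, self_mem_succ,
        succ_mem_succ (succ_mem_omega hn) h2⟩
    · rw [walkStep_succ]
      exact ⟨_, _, _, ha', succ_mem_omega hb, hd, rfl,
        sub_of_mem (succ_mem_omega hd) h1 _ self_mem_succ, mem_succ_of_mem h2⟩
  have down : ∀ d, ∀ a ∈ omega M, ∀ n b, n ∈ omega M → app r n = opair a (opair b d) →
      ∃ m b', m ∈ omega M ∧ app r m = opair emp (opair b' d) := by
    intro d
    refine omega_induction (fun n b hn e => ⟨n, b, hn, e⟩) fun a ha ih n b hn e => ?_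
    refine ih (succ n) (succ b) (succ_mem_omega hn) ?_
    rw [hrs n hn, e, walkStep_succ]
  have diag : ∀ d ∈ omega M, ∃ n, n ∈ omega M ∧ app r n = opair d (opair emp d) := by
    refine omega_induction ⟨emp, emp_mem_omega, hr0⟩ ?_
    rintro d hd ⟨n, hn, e⟩
    obtain ⟨m, b', hm, e'⟩ := down d d hd n emp hn e
    exact ⟨succ m, succ_mem_omega hm, by rw [hrs m hm, e', walkStep_emp]⟩
  -- The pair `(a, b + 1)` is visited one step after `(a + 1, b)`, and `(a, 0)` starts the
  -- antidiagonal of `a`.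
  have all : ∀ b ∈ omega M, ∀ a, a ∈ omega M → ∃ n d, n ∈ omega M ∧
      app r n = opair a (opair b d) := by
    refine omega_induction (fun a ha => ?_) fun b hb ih a ha => ?_
    · obtain ⟨n, hn, e⟩ := diag a ha
      exact ⟨n, a, hn, e⟩
    · obtain ⟨n, d, hn, e⟩ := ih (succ a) (succ_mem_omega ha)
      exact ⟨succ n, d, succ_mem_omega hn, by rw [hrs n hn, e, walkStep_succ]⟩
  have h1 : ∀ n ∈ omega M, fst (app r n) ∈ omega M := fun n hn => by
    obtain ⟨a, b, d, ha, hb, hd, e⟩ := form n hn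
    rwa [e, fst_opair]
  have h2 : ∀ n ∈ omega M, fst (snd (app r n)) ∈ omega M := fun n hn => by
    obtain ⟨a, b, d, ha, hb, hd, e⟩ := form n hn
    rwa [e, snd_opair, fst_opair]
  refine ⟨lam (omega M) (omega M) fun n => fst (app r n),
    lam (omega M) (omega M) fun n => fst (snd (app r n)), isFun_lam h1, isFun_lam h2,
    fun c hc => ?_, fun a ha b hb => ?_⟩
  · rw [app_lam h1 hc]
    obtain ⟨a, b, d, ha, hb, hd, e, h, h'⟩ := bound c hc
    rw [e, fst_opair]
    rcases mem_succ.1 h with h | rfl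
    · exact sub_of_mem (succ_mem_omega hc) h' _ h
    · exact h'
  · obtain ⟨n, d, hn, e⟩ := all b hb a ha
    refine ⟨n, hn, ?_, ?_⟩
    · rw [app_lam h1 hn, e, fst_opair]
    · rw [app_lam h2 hn, e, snd_opair, fst_opair]

/-- A step of the enumeration of the finite sequences. -/
noncomputable def enumStep (P₁ P₂ s : M) : M :=
  cases (dom s = emp) emp (snoc (app s (app P₁ (pred (dom s)))) (app P₂ (pred (dom s))))

instance DefFun.enumStep (P₁ P₂ : M) {x : (ℕ → M) → M} [hx : DefFun x] :
    DefFun fun v => SetModel.enumStep P₁ P₂ (x v) := by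
  unfold SetModel.enumStep; infer_instance

variable (M) in
/-- Functions `D₁`, `D₂` on `ω` such that `n ↦ (D₁(n), D₂(n))` is onto `ω^{<ω} × ω`. -/
theorem exists_coding : ∃ D₁ D₂ : M, IsFun D₁ (omega M) (seqs (omega M)) ∧
    IsFun D₂ (omega M) (omega M) ∧ ∀ t ∈ seqs (omega M), ∀ n ∈ omega M,
      ∃ c, c ∈ omega M ∧ app D₁ c = t ∧ app D₂ c = n := by
  obtain ⟨P₁, P₂, hP₁, hP₂, hle, hsurj⟩ := exists_pairing M
  -- The enumeration is `e(0) = ∅`, `e(n + 1) = e(P₁(n)) ⌢ P₂(n)`. It is onto by induction on the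
  -- length of the sequence.
  obtain ⟨e, he, h⟩ := exists_recursion (seqs (omega M)) (enumStep P₁ P₂) fun s hs => by
      rw [enumStep]
      by_cases h : dom s = emp
      · rw [cases_pos h]
        exact emp_mem_seqs _
      · rw [cases_neg h]
        rcases eq_emp_or_succ (dom_mem_omega hs) with h' | ⟨m, hm, h'⟩
        · exact absurd h' h
        · rw [h', pred_succ]
          refine snoc_mem_seqs ((isFun_of_mem_seqs hs).app_mem ?_) (hP₂.app_mem hm)
          rw [h']
          exact hle m hm
  have h0 : app e emp = emp := by
    rw [h emp emp_mem_omega, enumStep, restr_emp, (isFun_emp emp).dom_eq, cases_pos rfl]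
  have hs : ∀ n ∈ omega M, app e (succ n) = snoc (app e (app P₁ n)) (app P₂ n) := fun n hn => by
    have hn' := succ_mem_omega hn
    rw [h _ hn', enumStep, (he.restr (sub_omega hn')).dom_eq, cases_neg succ_ne_emp, pred_succ,
      app_restr (hle n hn)]
  have esurj : ∀ n ∈ omega M, ∀ s, IsFun s n (omega M) → ∃ c, c ∈ omega M ∧ app e c = s := by
    refine omega_induction (fun s hs => ⟨emp, emp_mem_omega, h0.trans ?_⟩) fun n hn ih s hs' => ?_
    · exact (isFun_emp (omega M)).ext hs fun x hx => (notMem_emp hx).elim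
    · obtain ⟨c, hc, ec⟩ := ih (restr s n) (hs'.restr sub_succ)
      obtain ⟨d, hd, e1, e2⟩ := hsurj c hc (app s n) (hs'.app_mem self_mem_succ)
      refine ⟨succ d, succ_mem_omega hd, ?_⟩
      rw [hs d hd, e1, e2, ec, ← restr_succ hs' fun _ => id, hs'.restr_eq_self fun _ => id]
  have hD : ∀ c ∈ omega M, app e (app P₁ c) ∈ seqs (omega M) := fun c hc =>
    he.app_mem (hP₁.app_mem hc)
  refine ⟨lam (omega M) (seqs (omega M)) fun c => app e (app P₁ c), P₂, isFun_lam hD, hP₂,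
    fun t ht n hn => ?_⟩
  obtain ⟨k, hk, ek⟩ := esurj _ (dom_mem_omega ht) t (isFun_of_mem_seqs ht)
  obtain ⟨c, hc, e1, e2⟩ := hsurj k hk n hn
  exact ⟨c, hc, by rw [app_lam hD hc, e1, ek], e2⟩

end Enumeration
end SetModel

namespace SetModel

/-! ### The game, and a winning strategy of the first player -/

section Game

variable {M : Type u} [Membership M M] [ZF M]

/-- `n ↦ (D₁(n), D₂(n))` maps `ω` onto `ω^{<ω} × ω`. -/
structure IsCoding (D₁ D₂ : M) : Prop where
  isFun₁ : IsFun D₁ (omega M) (seqs (omega M))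
  isFun₂ : IsFun D₂ (omega M) (omega M)
  surj : ∀ t ∈ seqs (omega M), ∀ n ∈ omega M, ∃ c, c ∈ omega M ∧ app D₁ c = t ∧ app D₂ c = n

/-- In the game for `A`, the first player plays codes `x(k)` of pairs `(t_k, n_k)` and the second
player answers `y(k)`. The first player wins if there is `h ∈ A` extending all `t_k` and taking
the value `y(k)` at `n_k` if this is allowed, and `|t_k| ≤ n_k < |t_{k + 1}|`. -/
def Won (D₁ D₂ g A x y h : M) : Prop :=
  h ∈ A ∧ ∀ k, k ∈ omega M → ¬ app D₂ (app x k) ∈ dom (app D₁ (app x k)) ∧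
    restr h (dom (app D₁ (app x k))) = app D₁ (app x k) ∧
    (app y k ∈ app g (app D₂ (app x k)) → app h (app D₂ (app x k)) = app y k) ∧
    app D₂ (app x k) ∈ dom (app D₁ (app x (succ k)))

instance DefPred.won (D₁ D₂ g A : M) {x y h : (ℕ → M) → M} [hx : DefFun x] [hy : DefFun y]
    [hh : DefFun h] : DefPred fun v => Won D₁ D₂ g A (x v) (y v) (h v) :=
  DefPred.comp₃ (by unfold Won; infer_instance) hx hy hh

theorem isFinSeq_iff {t : M} : IsFinSeq (omega M) t ↔ t ∈ seqs (omega M) := mem_seqs.symm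

theorem IsStrategy.isFun {σ : M} (h : IsStrategy (omega M) σ) :
    IsFun σ (seqs (omega M)) (omega M) := by
  obtain ⟨S, hS, h⟩ := h
  have : S = seqs (omega M) := set_ext fun t => (hS t).trans isFinSeq_iff
  exact this ▸ h

theorem inProd_iff {g h : M} (hg : IsFun g (omega M) (omega M)) :
    InProd (omega M) g h ↔
      IsFun h (omega M) (omega M) ∧ ∀ n ∈ omega M, app h n ∈ app g n := by
  refine and_congr_right fun hh => ⟨fun H n hn => ?_, fun H n a b hn ha hb => ?_⟩
  · exact H n _ _ hn (hh.maps_iff.2 ⟨hn, rfl⟩) (hg.maps_iff.2 ⟨hn, rfl⟩)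
  · rw [← (hh.maps_iff.1 ha).2, ← (hg.maps_iff.1 hb).2]
    exact H n hn

section Won

variable {D₁ D₂ g A x y h : M} (hD : IsCoding D₁ D₂) (hx : IsFun x (omega M) (omega M))
  (hW : Won D₁ D₂ g A x y h)

include hD in
theorem IsCoding.dom_mem {c : M} (hc : c ∈ omega M) : dom (app D₁ c) ∈ omega M :=
  dom_mem_omega (hD.isFun₁.app_mem hc)

include hD hx hW

theorem Won.dom_sub {k : M} (hk : k ∈ omega M) :
    Sub (dom (app D₁ (app x k))) (app D₂ (app x k)) :=
  sub_of_notMem (hD.isFun₂.app_mem (hx.app_mem hk)) (hD.dom_mem (hx.app_mem hk)) (hW.2 k hk).1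

theorem Won.mem_dom {j k : M} (hk : k ∈ omega M) :
    j ∈ k → app D₂ (app x j) ∈ dom (app D₁ (app x k)) := by
  refine omega_induction (P := fun k => j ∈ k → app D₂ (app x j) ∈ dom (app D₁ (app x k)))
    (fun h => (notMem_emp h).elim) (fun k hk ih hj => ?_) k hk
  rcases mem_succ.1 hj with h | rfl
  · exact sub_of_mem (hD.dom_mem (hx.app_mem (succ_mem_omega hk))) (hW.2 k hk).2.2.2 _
      (hW.dom_sub hD hx hk _ (ih h))
  · exact (hW.2 j hk).2.2.2

/-- The lengths `|t_k|` strictly increase, so `k ≤ |t_k|`. Hence the `t_k` exhaust `h`, and late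
challenges lie beyond any given level. -/
theorem Won.sub_dom {k : M} (hk : k ∈ omega M) : Sub k (dom (app D₁ (app x k))) := by
  refine omega_induction (P := fun k => Sub k (dom (app D₁ (app x k))))
    (fun _ h => (notMem_emp h).elim) (fun k hk ih => ?_) k hk
  have h1 := hD.dom_mem (hx.app_mem (succ_mem_omega hk))
  have h2 := (hW.2 k hk).2.2.2
  have h3 : Sub k (app D₂ (app x k)) := fun i hi => hW.dom_sub hD hx hk i (ih i hi)
  have h4 : k ∈ dom (app D₁ (app x (succ k))) := by
    rcases omega_trichotomy (hD.isFun₂.app_mem (hx.app_mem hk)) hk with h | h | h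
    · exact sub_of_mem h1 h2 _ h
    · rwa [← h] at h2
    · exact absurd h (notMem_of_sub h3)
  intro i hi
  rcases mem_succ.1 hi with hi | rfl
  · exact sub_of_mem h1 h4 i hi
  · exact h4

end Won

/-- the moves of the first player who follows `σ` against `y` -/
noncomputable def firstMoves (σ y : M) : M :=
  lam (omega M) (omega M) fun n => app σ (restr y n)

instance DefFun.firstMoves {x y : (ℕ → M) → M} [hx : DefFun x] [hy : DefFun y] :
    DefFun fun v => SetModel.firstMoves (x v) (y v) :=
  DefFun.comp₂ (by unfold SetModel.firstMoves; infer_instance) hx hy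

section First

variable {σ y : M} (hσ : IsFun σ (seqs (omega M)) (omega M)) (hy : IsFun y (omega M) (omega M))

include hσ hy

theorem isFun_firstMoves : IsFun (firstMoves σ y) (omega M) (omega M) :=
  isFun_lam fun _ hn => hσ.app_mem (hy.restr_mem_seqs hn)

theorem app_firstMoves {n : M} (hn : n ∈ omega M) :
    app (firstMoves σ y) n = app σ (restr y n) :=
  app_lam (fun _ hn => hσ.app_mem (hy.restr_mem_seqs hn)) hn

theorem firstFollows_firstMoves : FirstFollows (omega M) σ (firstMoves σ y) y := by
  intro n hn s a hs ha
  rw [(isFun_firstMoves hσ hy).maps_iff, app_firstMoves hσ hy hn] at ha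
  rw [isRestr_iff] at hs
  rw [hσ.maps_iff, hs]
  exact ⟨hy.restr_mem_seqs hn, ha.2⟩

end First

/-- A winning strategy of the first player yields a thick tree all of whose branches are
in `A`. -/
theorem exists_thick_of_first {D₁ D₂ g A σ : M} (hD : IsCoding D₁ D₂)
    (hg : IsFun g (omega M) (omega M)) (hA : ∀ h ∈ A, InProd (omega M) g h)
    (hg0 : ∀ n ∈ omega M, emp ∈ app g n) (hσ : IsFun σ (seqs (omega M)) (omega M))
    (hwin : ∀ y, IsFun y (omega M) (omega M) → ∃ h, Won D₁ D₂ g A (firstMoves σ y) y h) :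
    ∃ T, IsThick (omega M) g T ∧ ∀ h, IsBranch (omega M) T h → h ∈ A := by
  -- In a legal run every answer really is the value of `h` at the challenged position.
  set legal : M → M → Prop := fun y h => IsFun y (omega M) (omega M) ∧
    Won D₁ D₂ g A (firstMoves σ y) y h ∧
    ∀ k, k ∈ omega M → app h (app D₂ (app (firstMoves σ y) k)) = app y k with hlegal
  set T : M := sep (seqs (omega M)) fun s => ∃ y h n, n ∈ omega M ∧
    (IsFun y (omega M) (omega M) ∧
      Won D₁ D₂ g A (firstMoves σ y) y h ∧
      ∀ k, k ∈ omega M → app h (app D₂ (app (firstMoves σ y) k)) = app y k) ∧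
    s = restr h n with hT
  have hAf : ∀ {h}, h ∈ A → IsFun h (omega M) (omega M) := fun h => (hA _ h).1
  have memT : ∀ {s}, s ∈ T ↔ ∃ y h n, n ∈ omega M ∧ legal y h ∧ s = restr h n := by
    intro s
    rw [hT, mem_sep, and_iff_right_iff_imp]
    rintro ⟨y, h, n, hn, H, rfl⟩
    exact (hAf H.2.1.1).restr_mem_seqs hn
  have Dω : ∀ {y k}, IsFun y (omega M) (omega M) → k ∈ omega M →
      app D₂ (app (firstMoves σ y) k) ∈ omega M := fun hy hk =>
    hD.isFun₂.app_mem ((isFun_firstMoves hσ hy).app_mem hk)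
  have legal_of : ∀ y, IsFun y (omega M) (omega M) →
      (∀ k ∈ omega M, app y k ∈ app g (app D₂ (app (firstMoves σ y) k))) → ∃ h, legal y h := by
    intro y hy H
    obtain ⟨h, hW⟩ := hwin y hy
    exact ⟨h, hy, hW, fun k hk => (hW.2 k hk).2.2.1 (H k hk)⟩
  refine ⟨T, ⟨fun t ht => isFinSeq_iff.2 (mem_sep.1 ht).1, ?_, ?_, ?_, ?_⟩, ?_⟩
  · have h0 : ∀ n ∈ omega M, (emp : M) ∈ omega M := fun _ _ => emp_mem_omega
    obtain ⟨h, H⟩ := legal_of (lam (omega M) (omega M) fun _ => emp) (isFun_lam h0)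
      fun k hk => by
        rw [app_lam h0 hk]
        exact hg0 _ (Dω (isFun_lam h0) hk)
    exact ⟨_, memT.2 ⟨_, h, emp, emp_mem_omega, H, rfl⟩⟩
  · intro t n s ht hn hs
    obtain ⟨y, h, m, hm, H, rfl⟩ := memT.1 ht
    rw [isRestr_iff] at hs
    by_cases hmn : m ∈ n
    · rw [((hAf H.2.1.1).restr (sub_omega hm)).restr_eq_self (sub_of_mem hn hmn)] at hs
      exact hs ▸ ht
    · rw [restr_restr (sub_of_notMem hm hn hmn)] at hs
      exact memT.2 ⟨y, h, n, hn, H, hs⟩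
  · intro t n a b ht ha hb
    obtain ⟨y, h, m, hm, H, rfl⟩ := memT.1 ht
    rw [((hAf H.2.1.1).restr (sub_omega hm)).maps_iff] at ha
    rw [hg.maps_iff] at hb
    rw [← ha.2, ← hb.2, app_restr ha.1]
    exact ((inProd_iff hg).1 (hA h H.2.1.1)).2 n hb.1
  · intro t ht
    obtain ⟨y, h, N, hN, H, rfl⟩ := memT.1 ht
    have hh := hAf H.2.1.1
    obtain ⟨hy, hW, heq⟩ := H
    have hx := isFun_firstMoves hσ hy
    have hk := succ_mem_omega hN
    -- Level `N` is split at the challenge of stage `N + 1`, which lies beyond it because `|t_k| ≥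
    -- k`.
    set k := succ N with hkdef
    have hNd : Sub N (dom (app D₁ (app (firstMoves σ y) k))) := fun i hi =>
      hW.sub_dom hD hx hk i (sub_succ i hi)
    refine ⟨app D₂ (app (firstMoves σ y) k), Dω hy hk, fun a ha => ?_, fun b m hb hm => ?_⟩
    · rw [(hh.restr (sub_omega hN)).maps_iff] at ha
      exact (hW.2 k hk).1 (hNd _ ha.1)
    · rw [hg.maps_iff] at hb
      rw [← hb.2] at hm
      have hmω : m ∈ omega M := mem_omega_of_mem (hg.app_mem hb.1) hm
      -- Repeat the answers of `y` before `k`, answer `m` at stage `k`, and answer `0` from then on.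
      -- The moves of `σ` up to stage `k` stay the same, and all answers are allowed.
      set t' : M → M := fun j => cases (j ∈ k) (app y j) (cases (j = k) m emp) with ht'
      have htd : DefFun fun v : ℕ → M => t' (v 0) := by simp only [ht']; infer_instance
      have ht'ω : ∀ j ∈ omega M, t' j ∈ omega M := fun j hj => by
        simp only [ht']
        by_cases h1 : j ∈ k
        · rw [cases_pos h1]; exact hy.app_mem hj
        · rw [cases_neg h1]
          by_cases h2 : j = k
          · rwa [cases_pos h2]
          · rw [cases_neg h2]; exact emp_mem_omega
      set y' := lam (omega M) (omega M) t' with hy'def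
      have hy' : IsFun y' (omega M) (omega M) := isFun_lam ht'ω
      have hx' := isFun_firstMoves hσ hy'
      have hagree : ∀ j ∈ k, app y' j = app y j := fun j hj => by
        rw [hy'def, app_lam ht'ω (mem_omega_of_mem hk hj)]
        exact cases_pos hj
      have hyk : app y' k = m := by
        rw [hy'def, app_lam ht'ω hk]
        exact (cases_neg (mem_irrefl k)).trans (cases_pos rfl)
      have hmove : ∀ j ∈ omega M, Sub j k →
          app (firstMoves σ y') j = app (firstMoves σ y) j := fun j hj hjk => by
        rw [app_firstMoves hσ hy' hj, app_firstMoves hσ hy hj]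
        congr 1
        exact hy'.restr_congr hy (sub_omega hj) (sub_omega hj) fun i hi => hagree i (hjk i hi)
      obtain ⟨h', H'⟩ := legal_of y' hy' fun j hj => by
        rcases omega_trichotomy hk hj with hjk | rfl | hjk
        · rw [hmove j hj (sub_of_mem hk hjk), hagree j hjk, ← heq j hj]
          exact ((inProd_iff hg).1 (hA h hW.1)).2 _ (Dω hy hj)
        · rw [hmove _ hj fun _ => id, hyk]
          exact hm
        · have h1 : j ∉ k := fun h => mem_asymm h hjk
          have h2 : j ≠ k := fun h => mem_irrefl j (by rw [h] at hjk ⊢; exact hjk)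
          have : app y' j = emp := by
            rw [hy'def, app_lam ht'ω hj]
            exact (cases_neg h1).trans (cases_neg h2)
          rw [this]
          exact hg0 _ (Dω hy' hj)
      have hh' := hAf H'.2.1.1
      have hn := Dω hy hk
      have hn' := succ_mem_omega hn
      set n := app D₂ (app (firstMoves σ y) k) with hndef
      have hNn : Sub N n := fun i hi => hW.dom_sub hD hx hk i (hNd i hi)
      -- Both extend the same `t_k`, whose length is at least `N`.
      have hrestr : restr h N = restr h' N := by
        have h1 := (hW.2 k hk).2.1
        have h2 := (H'.2.1.2 k hk).2.1
        rw [hmove k hk fun _ => id] at h2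
        rw [← restr_restr hNd, h1, ← h2, restr_restr hNd]
      refine ⟨restr h' (succ n), memT.2 ⟨y', h', _, hn', H', rfl⟩, ?_, ?_⟩
      · rw [hrestr, ← restr_restr (f := h') (fun i hi => sub_succ i (hNn i hi))]
        exact restr_sub _ _
      · rw [(hh'.restr (sub_omega hn')).maps_iff]
        refine ⟨self_mem_succ, ?_⟩
        have h1 := H'.2.2 k hk
        rw [hmove k hk fun _ => id, hyk] at h1
        rw [app_restr self_mem_succ, h1]
  · rintro h ⟨hh, hbr⟩
    have hrT : ∀ n ∈ omega M, ∃ y' h', legal y' h' ∧ restr h n = restr h' n := by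
      intro n hn
      obtain ⟨y', h', m, hm, H, e⟩ := memT.1 (hbr n _ hn (isRestr_iff.2 rfl))
      have := congrArg dom e
      rw [(hh.restr (sub_omega hn)).dom_eq, ((hAf H.2.1.1).restr (sub_omega hm)).dom_eq] at this
      exact ⟨y', h', H, this ▸ e⟩
    have hhg : ∀ n ∈ omega M, app h n ∈ app g n := fun n hn => by
      obtain ⟨y', h', H, e⟩ := hrT (succ n) (succ_mem_omega hn)
      rw [← app_restr (f := h) (self_mem_succ (x := n)), e, app_restr self_mem_succ]
      exact ((inProd_iff hg).1 (hA h' H.2.1.1)).2 n hn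
    -- Against `σ`, let the second player read the answers off the branch `h`. The winning `h₀` will
    -- turn out to be `h`.
    obtain ⟨y, hy, hyrec⟩ := exists_recursion (omega M) (fun s => app h (app D₂ (app σ s)))
      fun s hs => hh.app_mem (hD.isFun₂.app_mem (hσ.app_mem hs))
    have hyk : ∀ k ∈ omega M, app y k = app h (app D₂ (app (firstMoves σ y) k)) := fun k hk => by
      rw [hyrec k hk, app_firstMoves hσ hy hk]
    have hx := isFun_firstMoves hσ hy
    obtain ⟨h₀, hW⟩ := hwin y hy
    have key : ∀ k ∈ omega M, restr h (dom (app D₁ (app (firstMoves σ y) k))) =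
        app D₁ (app (firstMoves σ y) k) := by
      intro k hk
      have hN := hD.dom_mem (hx.app_mem hk)
      obtain ⟨y', h', H, e⟩ := hrT _ hN
      have hx' := isFun_firstMoves hσ H.1
      have hmove : ∀ j ∈ omega M, (∀ i ∈ j, app y' i = app y i) →
          app (firstMoves σ y') j = app (firstMoves σ y) j := fun j hj H' => by
        rw [app_firstMoves hσ H.1 hj, app_firstMoves hσ hy hj]
        congr 1
        exact H.1.restr_congr hy (sub_omega hj) (sub_omega hj) H'
      -- For `j < k` the challenge `n_j` lies below `|t_k|`, where `h` and `h'` agree. So the two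
      -- runs receive the same answers, and inductively the same challenges, before stage `k`.
      have hagree : ∀ j ∈ omega M, j ∈ k → app y' j = app y j := by
        refine omega_strong_induction fun j hj ih hjk => ?_
        have hm := hmove j hj fun i hi => ih i hi (sub_of_mem hk hjk i hi)
        rw [← H.2.2 j hj, hyk j hj, hm]
        have hd := hW.mem_dom hD hx hk hjk
        rw [← app_restr (f := h') hd, ← e, app_restr hd]
      have hm := hmove k hk fun i hi => hagree i (mem_omega_of_mem hk hi) hi
      have := (H.2.1.2 k hk).2.1
      rw [hm] at this
      rw [e, this]
    -- Both extend every `t_k`, and these determine all values.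
    have : h = h₀ := hh.ext (hAf hW.1) fun n hn => by
      have hn' := succ_mem_omega hn
      have hd := hW.sub_dom hD hx hn' n self_mem_succ
      rw [← app_restr hd, key _ hn', ← (hW.2 _ hn').2.1, app_restr hd]
    exact this ▸ hW.1

end Game
end SetModel

namespace SetModel

/-! ### A winning strategy of the second player, and the theorem under AD -/

section Second

variable {M : Type u} [Membership M M] [ZF M]

/-- the moves of the second player who follows `τ` against `x` -/
noncomputable def secondMoves (τ x : M) : M :=
  lam (omega M) (omega M) fun n => app τ (restr x (succ n))

theorem isFun_secondMoves {τ x : M} (hτ : IsFun τ (seqs (omega M)) (omega M))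
    (hx : IsFun x (omega M) (omega M)) : IsFun (secondMoves τ x) (omega M) (omega M) :=
  isFun_lam fun _ hn => hτ.app_mem (hx.restr_mem_seqs (succ_mem_omega hn))

theorem app_secondMoves {τ x n : M} (hτ : IsFun τ (seqs (omega M)) (omega M))
    (hx : IsFun x (omega M) (omega M)) (hn : n ∈ omega M) :
    app (secondMoves τ x) n = app τ (restr x (succ n)) :=
  app_lam (fun _ hn => hτ.app_mem (hx.restr_mem_seqs (succ_mem_omega hn))) hn

theorem secondFollows_secondMoves {τ x : M} (hτ : IsFun τ (seqs (omega M)) (omega M))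
    (hx : IsFun x (omega M) (omega M)) : SecondFollows (omega M) τ x (secondMoves τ x) := by
  intro n k hn hk s b hs hb
  rw [(isFun_secondMoves hτ hx).maps_iff, app_secondMoves hτ hx hn] at hb
  rw [isRestr_iff, isSucc_iff.1 hk] at hs
  rw [hτ.maps_iff, hs]
  exact ⟨hx.restr_mem_seqs (succ_mem_omega hn), hb.2⟩

/-- the least code of the pair `(t, n)` -/
noncomputable def code (D₁ D₂ t n : M) : M := least fun c => app D₁ c = t ∧ app D₂ c = n

instance DefFun.code {D₁ D₂ : M} {x y : (ℕ → M) → M} [hx : DefFun x] [hy : DefFun y] :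
    DefFun fun v => SetModel.code D₁ D₂ (x v) (y v) :=
  DefFun.comp₂ (by unfold SetModel.code; infer_instance) hx hy

theorem IsCoding.code_spec {D₁ D₂ t n : M} (hD : IsCoding D₁ D₂) (ht : t ∈ seqs (omega M))
    (hn : n ∈ omega M) :
    code D₁ D₂ t n ∈ omega M ∧ app D₁ (code D₁ D₂ t n) = t ∧ app D₂ (code D₁ D₂ t n) = n :=
  least_spec (P := fun c => app D₁ c = t ∧ app D₂ c = n) (hD.surj t ht n hn)

/-- The answer that `τ` gives, after the first player has played the moves `s`, to the challenge
at `n` with the finite sequence `t`, or `0` if this answer is not allowed. -/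
noncomputable def answer (D₁ D₂ g τ s t n : M) : M :=
  cases (app τ (snoc s (code D₁ D₂ t n)) ∈ app g n) (app τ (snoc s (code D₁ D₂ t n))) emp

instance DefFun.answer {D₁ D₂ g τ : M} {s t n : (ℕ → M) → M} [hs : DefFun s] [ht : DefFun t]
    [hn : DefFun n] : DefFun fun v => SetModel.answer D₁ D₂ g τ (s v) (t v) (n v) := by
  unfold SetModel.answer; infer_instance

/-- the function of all answers to challenges with `t` after the moves `s` -/
noncomputable def answers (D₁ D₂ g τ s t : M) : M :=
  lam (omega M) (omega M) fun n => answer D₁ D₂ g τ s t n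

instance DefFun.answers {D₁ D₂ g τ : M} {s t : (ℕ → M) → M} [hs : DefFun s] [ht : DefFun t] :
    DefFun fun v => SetModel.answers D₁ D₂ g τ (s v) (t v) :=
  DefFun.comp₂ (by unfold SetModel.answers; infer_instance) hs ht

/-- The moves `s` of the first player comply with `h` in the run against `τ`. -/
def Complies (D₁ D₂ g τ h s : M) : Prop :=
  s ∈ seqs (omega M) ∧ ∀ k, k ∈ dom s → ¬ app D₂ (app s k) ∈ dom (app D₁ (app s k)) ∧
    restr h (dom (app D₁ (app s k))) = app D₁ (app s k) ∧
    (app τ (restr s (succ k)) ∈ app g (app D₂ (app s k)) →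
      app h (app D₂ (app s k)) = app τ (restr s (succ k))) ∧
    (succ k ∈ dom s → app D₂ (app s k) ∈ dom (app D₁ (app s (succ k))))

instance DefPred.complies {D₁ D₂ g τ h : M} {s : (ℕ → M) → M} [hs : DefFun s] :
    DefPred fun v => Complies D₁ D₂ g τ h (s v) :=
  DefPred.comp₁ (by unfold Complies; infer_instance) hs

section

variable {D₁ D₂ g A τ : M} (hD : IsCoding D₁ D₂) (hg : IsFun g (omega M) (omega M))
  (hτ : IsFun τ (seqs (omega M)) (omega M))

include hD hτ

theorem answer_mem {s t n : M} (hs : s ∈ seqs (omega M)) (ht : t ∈ seqs (omega M))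
    (hn : n ∈ omega M) : answer D₁ D₂ g τ s t n ∈ omega M := by
  rw [answer]
  by_cases h : app τ (snoc s (code D₁ D₂ t n)) ∈ app g n
  · rw [cases_pos h]
    exact hτ.app_mem (snoc_mem_seqs hs (hD.code_spec ht hn).1)
  · rw [cases_neg h]
    exact emp_mem_omega

theorem isFun_answers {s t : M} (hs : s ∈ seqs (omega M)) (ht : t ∈ seqs (omega M)) :
    IsFun (answers D₁ D₂ g τ s t) (omega M) (omega M) :=
  isFun_lam fun _ hn => answer_mem hD hτ hs ht hn

theorem app_answers {s t n : M} (hs : s ∈ seqs (omega M)) (ht : t ∈ seqs (omega M))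
    (hn : n ∈ omega M) : app (answers D₁ D₂ g τ s t) n = answer D₁ D₂ g τ s t n :=
  app_lam (fun _ hn => answer_mem hD hτ hs ht hn) hn

theorem inProd_answers (hg : IsFun g (omega M) (omega M)) (hg0 : ∀ n ∈ omega M, emp ∈ app g n)
    {s t : M} (hs : s ∈ seqs (omega M)) (ht : t ∈ seqs (omega M)) :
    InProd (omega M) g (answers D₁ D₂ g τ s t) := by
  refine (inProd_iff hg).2 ⟨isFun_answers hD hτ hs ht, fun n hn => ?_⟩
  rw [app_answers hD hτ hs ht hn, answer]
  by_cases h : app τ (snoc s (code D₁ D₂ t n)) ∈ app g n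
  · rwa [cases_pos h]
  · rw [cases_neg h]
    exact hg0 n hn

/-- If `h` meets all `answers` infinitely often, compliant positions can be extended. -/
theorem Complies.extend {h : M} (hh : IsFun h (omega M) (omega M))
    (hmeet : ∀ s ∈ seqs (omega M), ∀ t ∈ seqs (omega M),
      ¬ FiniteMeet (omega M) (answers D₁ D₂ g τ s t) h)
    {s : M} (hs : Complies D₁ D₂ g τ h s) :
    ∃ c, c ∈ omega M ∧ Complies D₁ D₂ g τ h (snoc s c) := by
  obtain ⟨hs, H⟩ := hs
  have hsf := isFun_of_mem_seqs hs
  have hdω := dom_mem_omega hs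
  -- `N` is one more than the last challenged position, or `0` at the start of the run. The next
  -- move will be `t = h ↾ N`, which makes `n_k < |t_{k+1}|` hold.
  obtain ⟨N, hN, hNk⟩ : ∃ N, N ∈ omega M ∧ ∀ k, dom s = succ k → app D₂ (app s k) ∈ N := by
    rcases eq_emp_or_succ hdω with h0 | ⟨k, hk, hk'⟩
    · exact ⟨emp, emp_mem_omega, fun k hk => absurd (hk.symm.trans h0) succ_ne_emp⟩
    · refine ⟨succ (app D₂ (app s k)), succ_mem_omega (hD.isFun₂.app_mem (hsf.app_mem ?_)),
        fun j hj => ?_⟩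
      · exact hk' ▸ self_mem_succ
      · rw [succ_inj.1 (hj.symm.trans hk')]
        exact self_mem_succ
  have ht := hh.restr_mem_seqs hN
  have hdt : dom (restr h N) = N := (hh.restr (sub_omega hN)).dom_eq
  have hm := hmeet s hs _ ht
  simp only [FiniteMeet, not_exists, not_and, not_forall] at hm
  -- Challenge at a position `n ≥ N` where `h` agrees with the answers to `t`. If the answer of `τ`
  -- is allowed, it is then the value of `h`.
  obtain ⟨n, hn, hnN, a, hna⟩ := hm N hN
  rw [not_not, hh.maps_iff, (isFun_answers hD hτ hs ht).maps_iff, app_answers hD hτ hs ht hn] at hna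
  obtain ⟨⟨-, hha⟩, hnn, han⟩ := hna
  obtain ⟨hc, hc1, hc2⟩ := hD.code_spec ht hn
  rw [answer] at han
  set c := code D₁ D₂ (restr h N) n
  have hsc := isFun_snoc hsf hc
  refine ⟨c, hc, snoc_mem_seqs hs hc, fun k hk => ?_⟩
  rw [hsc.dom_eq] at hk ⊢
  rcases mem_succ.1 hk with hk' | rfl
  · have hsk : Sub (succ k) (dom s) := fun i hi => by
      rcases mem_succ.1 hi with hi | rfl
      exacts [sub_of_mem hdω hk' i hi, hk']
    have hr : restr (snoc s c) (succ k) = restr s (succ k) :=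
      hsc.restr_congr hsf (fun i hi => sub_succ i (hsk i hi)) hsk fun i hi =>
        app_snoc_of_mem hsf hc (hsk i hi)
    obtain ⟨h1, h2, h3, h4⟩ := H k hk'
    rw [app_snoc_of_mem hsf hc hk', hr]
    refine ⟨h1, h2, h3, fun hk2 => ?_⟩
    rcases succ_mem_or_eq hdω hk' with hk3 | hk3
    · rw [app_snoc_of_mem hsf hc hk3]
      exact h4 hk3
    · rw [hk3, app_snoc_self hsf hc, hc1, hdt]
      exact hNk k hk3.symm
  · rw [app_snoc_self hsf hc, hc1, hc2, hdt, hsc.restr_eq_self fun _ => id]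
    refine ⟨hnN, rfl, fun hlt => ?_, fun hmem => (mem_irrefl _ hmem).elim⟩
    rw [cases_pos hlt] at han
    rw [hha, han]

/-- Every `h` that meets all `answers` infinitely often gives a run won against `τ`. -/
theorem exists_won_of_meets {h : M} (hhA : h ∈ A) (hh : IsFun h (omega M) (omega M))
    (hmeet : ∀ s ∈ seqs (omega M), ∀ t ∈ seqs (omega M),
      ¬ FiniteMeet (omega M) (answers D₁ D₂ g τ s t) h) :
    ∃ x, IsFun x (omega M) (omega M) ∧ Won D₁ D₂ g A x (secondMoves τ x) h := by
  -- The implication makes a witness exist at every `s`, so that the run can be defined by always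
  -- playing the least one, without choice.
  set P : M → M → Prop := fun s c => Complies D₁ D₂ g τ h s → Complies D₁ D₂ g τ h (snoc s c)
    with hP
  have ex : ∀ s, ∃ c, c ∈ omega M ∧ P s c := fun s => by
    by_cases hs : Complies D₁ D₂ g τ h s
    · obtain ⟨c, hc, h'⟩ := hs.extend hD hτ hh hmeet
      exact ⟨c, hc, fun _ => h'⟩
    · exact ⟨emp, emp_mem_omega, fun h' => absurd h' hs⟩
  have hPd : ∀ s, DefPred fun v : ℕ → M => P s (v 0) := fun s => by
    simp only [hP]; infer_instance
  have hPd2 : DefFun fun v : ℕ → M => least (P (v 0)) := by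
    simp only [hP]; infer_instance
  obtain ⟨x, hx, hrec⟩ := exists_recursion (omega M) (fun s => least (P s))
    fun s _ => (least_spec (ex s)).1
  have good : ∀ n ∈ omega M, Complies D₁ D₂ g τ h (restr x n) := by
    refine omega_induction ?_ fun n hn ih => ?_
    · rw [restr_emp]
      refine ⟨emp_mem_seqs _, fun k hk => ?_⟩
      rw [(isFun_emp emp).dom_eq] at hk
      exact (notMem_emp hk).elim
    · rw [restr_succ hx (sub_omega (succ_mem_omega hn)), hrec n hn]
      exact (least_spec (ex (restr x n))).2 ih
  refine ⟨x, hx, hhA, fun k hk => ?_⟩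
  have hk1 := succ_mem_omega hk
  have hk2 := succ_mem_omega hk1
  have hkk : k ∈ succ (succ k) := mem_succ_of_mem self_mem_succ
  -- The position of length `k + 2` is needed because the condition at `k` also mentions the move at
  -- `k + 1`.
  obtain ⟨h1, h2, h3, h4⟩ := (good _ hk2).2 k (by rwa [(hx.restr (sub_omega hk2)).dom_eq])
  rw [(hx.restr (sub_omega hk2)).dom_eq] at h4
  rw [app_restr hkk] at h1 h2 h3 h4
  rw [restr_restr sub_succ] at h3
  rw [app_restr self_mem_succ] at h4
  rw [app_secondMoves hτ hx hk]
  exact ⟨h1, h2, h3, h4 self_mem_succ⟩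

end

/-- A winning strategy of the second player shows that `A` belongs to the ideal. -/
theorem inIdealIE_of_second {D₁ D₂ g A τ : M} (hD : IsCoding D₁ D₂)
    (hg : IsFun g (omega M) (omega M)) (hA : ∀ h ∈ A, InProd (omega M) g h)
    (hg0 : ∀ n ∈ omega M, emp ∈ app g n) (hτ : IsFun τ (seqs (omega M)) (omega M))
    (hwin : ∀ x h, IsFun x (omega M) (omega M) → ¬ Won D₁ D₂ g A x (secondMoves τ x) h) :
    InIdealIE (omega M) g A := by
  intro J hJ hgen
  -- The index `i` codes the pair of `s` and a number, and that number codes `t` by its first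
  -- component. So all `f_{s,t}` occur in one sequence indexed by `ω`.
  set f : M → M := fun i => answers D₁ D₂ g τ (app D₁ i) (app D₁ (app D₂ i)) with hf
  set X : M → M := fun i => sep (funSpace (omega M) (omega M)) fun h =>
    InProd (omega M) g h ∧ FiniteMeet (omega M) (f i) h with hX
  have hXd : DefFun fun v : ℕ → M => X (v 0) := by simp only [hX, hf]; infer_instance
  have hUd : DefPred fun v : ℕ → M => ∃ i, i ∈ omega M ∧ v 0 ∈ X i := by
    simp only [hX, hf]; infer_instance
  have hXd' : ∀ i, DefPred fun v : ℕ → M =>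
      InProd (omega M) g (v 0) ∧ FiniteMeet (omega M) (f i) (v 0) := fun i => inferInstance
  have memX : ∀ {i h}, h ∈ X i ↔ InProd (omega M) g h ∧ FiniteMeet (omega M) (f i) h := by
    intro i h
    rw [hX, mem_sep, and_iff_right_iff_imp]
    exact fun H => mem_funSpace.2 H.1.1
  have hXJ : ∀ i ∈ omega M, X i ∈ J := fun i hi =>
    hgen (f i) _ (inProd_answers hD hτ hg hg0 (hD.isFun₁.app_mem hi)
      (hD.isFun₁.app_mem (hD.isFun₂.app_mem hi))) fun h => memX
  have hU := hJ.iUnion_mem (lam (omega M) J X)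
    (sep (funSpace (omega M) (omega M)) fun h => ∃ i, i ∈ omega M ∧ h ∈ X i) (isFun_lam hXJ)
    fun h => by
      rw [mem_sep]
      constructor
      · rintro ⟨-, i, hi, h'⟩
        exact ⟨i, X i, hi, (isFun_lam hXJ).maps_iff.2 ⟨hi, app_lam hXJ hi⟩, h'⟩
      · rintro ⟨i, B, hi, hB, h'⟩
        rw [(isFun_lam hXJ).maps_iff, app_lam hXJ hi] at hB
        rw [← hB.2] at h'
        exact ⟨mem_funSpace.2 (memX.1 h').1.1, i, hi, h'⟩
  refine hJ.mem_of_subset _ A hU fun h hh => ?_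
  have hhf := (hA h hh).1
  refine mem_sep.2 ⟨mem_funSpace.2 hhf, ?_⟩
  by_contra hcon
  obtain ⟨x, hx, hW⟩ := exists_won_of_meets hD hτ hh hhf fun s hs t ht hfin => by
    obtain ⟨c, hc, hc1, -⟩ := hD.surj t ht emp emp_mem_omega
    obtain ⟨i, hi, hi1, hi2⟩ := hD.surj s hs c hc
    refine hcon ⟨i, hi, memX.2 ⟨hA h hh, ?_⟩⟩
    simp only [hf, hi1, hi2, hc1]
    exact hfin
  exact hwin x h hx hW

/-- Positivity makes `A` nonempty, hence `g > 0`, and excludes a winning strategy of the second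
player. The payoff set is the set of runs `(x, y)` won by means of some `h`. -/
theorem exists_thick_of_modelsAD (hAD : ModelsAD M) {g A : M} (hg : IsFun g (omega M) (omega M))
    (hA : ∀ h ∈ A, InProd (omega M) g h) (hpos : ¬ InIdealIE (omega M) g A) :
    ∃ T, IsThick (omega M) g T ∧ ∀ h, IsBranch (omega M) T h → h ∈ A := by
  rcases eq_emp_or_nonempty A with rfl | ⟨h₀, hh₀⟩
  · exact absurd (fun J hJ _ => hJ.empty_mem emp fun _ => notMem_emp) hpos
  have hg0 : ∀ n ∈ omega M, emp ∈ app g n := fun n hn => by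
    have h1 := ((inProd_iff hg).1 (hA h₀ hh₀)).2 n hn
    rcases emp_mem_or_eq (hg.app_mem hn) with h | h
    · exact (notMem_emp (h ▸ h1)).elim
    · exact h
  obtain ⟨D₁, D₂, hD₁, hD₂, hsurj⟩ := exists_coding M
  have hD : IsCoding D₁ D₂ := ⟨hD₁, hD₂, hsurj⟩
  have memW : ∀ {x y}, IsFun x (omega M) (omega M) → IsFun y (omega M) (omega M) →
      (Maps (sep (cart (funSpace (omega M) (omega M)) (funSpace (omega M) (omega M))) fun p =>
        ∃ x y h, p = opair x y ∧ Won D₁ D₂ g A x y h) x y ↔ ∃ h, Won D₁ D₂ g A x y h) := by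
    intro x y hx hy
    rw [maps_iff, mem_sep, opair_mem_cart, mem_funSpace, mem_funSpace]
    simp only [hx, hy, true_and]
    constructor
    · rintro ⟨x', y', h, e, hW⟩
      obtain ⟨rfl, rfl⟩ := opair_inj.1 e
      exact ⟨h, hW⟩
    · rintro ⟨h, hW⟩
      exact ⟨x, y, h, rfl, hW⟩
  rcases hAD (omega M) isOmega_omega _ with ⟨σ, hσ, hwin⟩ | ⟨τ, hτ, hwin⟩
  · have hσf := hσ.isFun
    exact exists_thick_of_first hD hg hA hg0 hσf fun y hy =>
      (memW (isFun_firstMoves hσf hy) hy).1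
        (hwin _ y (isFun_firstMoves hσf hy) hy (firstFollows_firstMoves hσf hy))
  · have hτf := hτ.isFun
    exact absurd (inIdealIE_of_second hD hg hA hg0 hτf fun x h hx hW =>
      hwin x _ hx (isFun_secondMoves hτf hx) (secondFollows_secondMoves hτf hx)
        ((memW hx (isFun_secondMoves hτf hx)).2 ⟨h, hW⟩)) hpos

end Second
end SetModel

/-! ### The Borel case and positivity of thick trees on the actual natural numbers -/

namespace ThickTree

open Set Filter Topology

/-- the initial segment of `h` of length `n` -/
abbrev init (h : ℕ → ℕ) (n : ℕ) : List ℕ := (List.range n).map h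

theorem getElem?_init_eq_some {h : ℕ → ℕ} {n i m : ℕ} :
    (init h n)[i]? = some m ↔ i < n ∧ h i = m := by
  simp [init, List.getElem?_eq_some_iff]

theorem init_prefix_init (h : ℕ → ℕ) {n m : ℕ} (hnm : n ≤ m) : init h n <+: init h m := by
  obtain ⟨k, rfl⟩ := Nat.exists_eq_add_of_le hnm
  rw [init, init, List.range_add, List.map_append]
  exact List.prefix_append _ _

theorem getElem?_of_prefix {s t : List ℕ} (h : s <+: t) {i m : ℕ} (hi : s[i]? = some m) :
    t[i]? = some m := by
  obtain ⟨r, rfl⟩ := h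
  rw [List.getElem?_append_left (List.getElem?_eq_some_iff.1 hi).1, hi]

theorem eq_init_of_forall {t : List ℕ} {h : ℕ → ℕ} (H : ∀ i m, t[i]? = some m → h i = m) :
    init h t.length = t := by
  refine List.ext_getElem (by simp) fun i h1 h2 => ?_
  simpa using H i _ (List.getElem?_eq_getElem h2)

theorem prefix_of_le {p : ℕ → List ℕ} (h : ∀ j, p j <+: p (j + 1)) {i j : ℕ} (hij : i ≤ j) :
    p i <+: p j := by
  induction hij with
  | refl => exact List.prefix_rfl
  | step _ ih => exact ih.trans (h _)

/-! ### The ideal -/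

theorem iUnion_mem_idealIE {g : ℕ → ℕ} {ι : Type*} [Countable ι] {F : ι → Set (ℕ → ℕ)}
    (h : ∀ i, F i ∈ idealIE g) : (⋃ i, F i) ∈ idealIE g := by
  cases isEmpty_or_nonempty ι
  · simpa using empty_mem_idealIE g
  · obtain ⟨e, he⟩ := exists_surjective_nat ι
    rw [← he.iUnion_comp]
    exact fun J hJ hf => hJ.iUnion_mem _ fun k => h (e k) J hJ hf

theorem finiteMeet_mem_idealIE {g f : ℕ → ℕ} (hf : f ∈ prodSpace g) :
    finiteMeet g f ∈ idealIE g := fun _ _ h => h f hf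

theorem nonempty_of_notMem_idealIE {g : ℕ → ℕ} {A : Set (ℕ → ℕ)} (hA : A ∉ idealIE g) :
    A.Nonempty := by
  by_contra h
  rw [not_nonempty_iff_eq_empty] at h
  exact hA (h ▸ empty_mem_idealIE g)

/-- The subsets of countable unions of generators already form a σ-ideal. Since `g > 0`, the product
has a point, which is needed to cover `∅`. -/
theorem exists_cover_of_mem_idealIE {g : ℕ → ℕ} (hg : ∀ n, 0 < g n) {A : Set (ℕ → ℕ)}
    (hA : A ∈ idealIE g) :
    ∃ f : ℕ → ℕ → ℕ, (∀ k, f k ∈ prodSpace g) ∧ A ⊆ ⋃ k, finiteMeet g (f k) := by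
  refine hA {A | ∃ f : ℕ → ℕ → ℕ, (∀ k, f k ∈ prodSpace g) ∧ A ⊆ ⋃ k, finiteMeet g (f k)}
    ⟨?_, ?_, ?_, ?_⟩ fun f hf => ⟨fun _ => f, fun _ => hf, subset_iUnion_of_subset 0 subset_rfl⟩
  · rintro B ⟨f, hf, hB⟩
    exact hB.trans (iUnion_subset fun k => sep_subset _ _)
  · exact ⟨fun _ _ => 0, fun _ => hg, empty_subset _⟩
  · rintro B ⟨f, hf, hB⟩ C hC
    exact ⟨f, hf, hC.trans hB⟩
  · intro F hF
    choose f hf hB using hF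
    refine ⟨fun k => f k.unpair.1 k.unpair.2, fun k => hf _ _, iUnion_subset fun k x hx => ?_⟩
    obtain ⟨l, hl⟩ := mem_iUnion.1 (hB k hx)
    exact mem_iUnion.2 ⟨Nat.pair k l, by simpa using hl⟩

/-! ### Thick trees in analytic positive sets -/

section Analytic

variable (g : ℕ → ℕ) (φ : (ℕ → ℕ) → ℕ → ℕ)

/-- the image under `φ` of the sequences extending `p.2`, intersected with the sequences
extending `p.1` -/
def piece (p : List ℕ × List ℕ) : Set (ℕ → ℕ) :=
  {h | ∃ y, φ y = h ∧ init h p.1.length = p.1 ∧ init y p.2.length = p.2}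

variable {g φ}

/-- Otherwise each `n ≥ |p.1|` has a bad value `f(n)`. A point of the piece either agrees with `f`
only finitely often, or passes through some bad value and so lies in a piece belonging to the ideal.
There are only countably many pieces, so `p` itself would be null. -/
theorem exists_splitting (hφ : ∀ y, φ y ∈ prodSpace g) {p : List ℕ × List ℕ}
    (hp : piece φ p ∉ idealIE g) :
    ∃ n, p.1.length ≤ n ∧ ∀ m < g n, ∃ q : List ℕ × List ℕ, piece φ q ∉ idealIE g ∧
      p.1 <+: q.1 ∧ q.1[n]? = some m ∧ p.2 <+: q.2 ∧ q.2.length = p.2.length + 1 := by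
  by_contra! H
  obtain ⟨h₀, y₀, rfl, -⟩ := nonempty_of_notMem_idealIE hp
  choose! f hf hfH using H
  -- Below `|p.1|` the values do not matter. Those of a point in the range keep `f'` in the product.
  set f' : ℕ → ℕ := fun n => if p.1.length ≤ n then f n else φ y₀ n with hf'
  have hf'mem : f' ∈ prodSpace g := fun n => by
    simp only [hf']
    split_ifs with h
    exacts [hf n h, hφ y₀ n]
  set Q : Set (List ℕ × List ℕ) := {q | piece φ q ∈ idealIE g} with hQ
  have hU : (⋃ q : Q, piece φ q.1) ∈ idealIE g := iUnion_mem_idealIE fun q => q.2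
  refine hp (mem_idealIE_of_subset_union (finiteMeet_mem_idealIE hf'mem) hU ?_)
  rintro _ ⟨y, rfl, h1, h2⟩
  by_cases hfin : {n | φ y n = f' n}.Finite
  · exact Or.inl ⟨hφ y, hfin⟩
  · obtain ⟨n, hn, hlt⟩ := (Set.not_finite.1 hfin : Set.Infinite _).exists_gt p.1.length
    rw [mem_ofPred_eq, hf'] at hn
    simp only [hlt.le, if_true] at hn
    -- The null piece is cut out by `φ y` up to and including the agreement at `n`, and by one more
    -- entry of `y`.
    refine Or.inr (mem_iUnion.2 ⟨⟨(init (φ y) (n + 1), init y (p.2.length + 1)), ?_⟩,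
      y, rfl, by simp, by simp⟩)
    by_contra hq
    refine hfH n hlt.le _ hq ?_ ?_ ?_ (by simp)
    · conv_lhs => rw [← h1]
      exact init_prefix_init _ (by omega)
    · exact getElem?_init_eq_some.2 ⟨by omega, hn⟩
    · conv_lhs => rw [← h2]
      exact init_prefix_init _ (by omega)

/-- Fix a splitting position and successors for every positive piece. Each `h` in the product steers
a sequence of positive pieces by supplying the values at the splitting positions. The tree consists
of the initial segments of their first components. -/
theorem exists_thick_subset_range (hφc : Continuous φ) (hφ : ∀ y, φ y ∈ prodSpace g)
    (hpos : range φ ∉ idealIE g) : ∃ T, IsThick g T ∧ branches T ⊆ range φ := by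
  have hroot : piece φ ([], []) ∉ idealIE g := by
    have : piece φ ([], []) = range φ := by ext; simp [piece]
    rwa [this]
  have hsplit := fun p : {p // piece φ p ∉ idealIE g} => exists_splitting hφ p.2
  choose N hN next hnext using hsplit
  classical
  -- The default `p` never occurs for `h` in the product.
  set F : (ℕ → ℕ) → {p // piece φ p ∉ idealIE g} → {p // piece φ p ∉ idealIE g} :=
    fun h p => if H : h (N p) < g (N p) then ⟨next p _ H, (hnext p _ H).1⟩ else p with hF
  set path : (ℕ → ℕ) → ℕ → {p // piece φ p ∉ idealIE g} :=
    fun h j => (F h)^[j] ⟨([], []), hroot⟩ with hpath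
  have path_succ : ∀ h j, path h (j + 1) = F h (path h j) := fun h j =>
    Function.iterate_succ_apply' _ _ _
  have step : ∀ {h}, h ∈ prodSpace g → ∀ j, (path h j).1.1 <+: (path h (j + 1)).1.1 ∧
      (path h (j + 1)).1.1[N (path h j)]? = some (h (N (path h j))) ∧
      (path h j).1.2 <+: (path h (j + 1)).1.2 ∧
      (path h (j + 1)).1.2.length = (path h j).1.2.length + 1 := fun {h} hh j => by
    have := (hnext (path h j) _ (hh (N (path h j)))).2
    rw [path_succ, hF]
    simpa only [dif_pos (hh (N (path h j)))] using this
  have mono₁ : ∀ {h}, h ∈ prodSpace g → ∀ {i j}, i ≤ j → (path h i).1.1 <+: (path h j).1.1 :=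
    fun {h} hh => prefix_of_le fun j => (step hh j).1
  have mono₂ : ∀ {h}, h ∈ prodSpace g → ∀ {i j}, i ≤ j → (path h i).1.2 <+: (path h j).1.2 :=
    fun {h} hh => prefix_of_le fun j => (step hh j).2.2.1
  have Nlt : ∀ {h}, h ∈ prodSpace g → ∀ {i j}, i < j → N (path h i) < (path h j).1.1.length :=
    fun {h} hh {i j} hij => (List.getElem?_eq_some_iff.1
      (getElem?_of_prefix (mono₁ hh hij) (step hh i).2.1)).1
  have len_lt : ∀ {h}, h ∈ prodSpace g → ∀ {i j}, i < j →
      (path h i).1.1.length < (path h j).1.1.length := fun {h} hh {i j} hij =>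
    (hN _).trans_lt (Nlt hh hij)
  have le_len : ∀ {h}, h ∈ prodSpace g → ∀ j, j ≤ (path h j).1.1.length := fun {h} hh j => by
    induction j with
    | zero => exact Nat.zero_le _
    | succ j ih => exact ih.trans_lt (len_lt hh j.lt_succ_self)
  have len₂ : ∀ {h}, h ∈ prodSpace g → ∀ j, (path h j).1.2.length = j := fun {h} hh j => by
    induction j with
    | zero => rfl
    | succ j ih => rw [(step hh j).2.2.2, ih]
  have congr_path : ∀ {h h'} k, (∀ i < k, h (N (path h i)) = h' (N (path h i))) →
      path h k = path h' k := fun {h h'} k H => by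
    induction k with
    | zero => rfl
    | succ k ih =>
      rw [path_succ, path_succ, ← ih fun i hi => H i (hi.trans k.lt_succ_self)]
      simp only [hF, H k k.lt_succ_self]
  obtain ⟨h₀, hh₀⟩ : (prodSpace g).Nonempty := ⟨φ 0, hφ 0⟩
  refine ⟨{s | ∃ h ∈ prodSpace g, ∃ j, s <+: (path h j).1.1}, ⟨⟨[], h₀, hh₀, 0, List.nil_prefix⟩,
    ?_, ?_, ?_⟩, ?_⟩
  · rintro t ⟨h, hh, j, ht⟩ s hs
    exact ⟨h, hh, j, hs.trans ht⟩
  · rintro t ⟨h, hh, j, ht⟩ i m hi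
    obtain ⟨_, y, rfl, h1, -⟩ := nonempty_of_notMem_idealIE (path h j).2
    have := getElem?_of_prefix ht hi
    rw [← h1, getElem?_init_eq_some] at this
    exact this.2 ▸ hφ y i
  · rintro t ⟨h, hh, j, ht⟩
    refine ⟨N (path h j), ht.length_le.trans (hN _), fun m hm => ?_⟩
    -- The earlier splitting positions are smaller, so this change leaves the first `j` steps as
    -- they were and steers step `j` to `m`.
    set h' := Function.update h (N (path h j)) m with hh'
    have hh'mem : h' ∈ prodSpace g := fun n => by
      rcases eq_or_ne n (N (path h j)) with rfl | hn
      · simpa [hh'] using hm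
      · simpa [hh', hn] using hh n
    have hpj : path h j = path h' j := congr_path j fun i hi => by
      rw [hh', Function.update_of_ne ((Nlt hh hi).trans_le (hN _)).ne]
    refine ⟨(path h' (j + 1)).1.1, ⟨h', hh'mem, j + 1, List.prefix_rfl⟩, ?_, ?_⟩
    · exact ht.trans (hpj ▸ (step hh'mem j).1)
    · have := (step hh'mem j).2.1
      rw [← hpj] at this
      rw [this, hh', Function.update_self]
  · intro h hbr
    have hh : h ∈ prodSpace g := fun n => by
      obtain ⟨h', hh', j, ht⟩ := hbr (n + 1)
      obtain ⟨_, y, rfl, h1, -⟩ := nonempty_of_notMem_idealIE (path h' j).2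
      have := getElem?_of_prefix ht (getElem?_init_eq_some.2 ⟨n.lt_succ_self, rfl⟩)
      rw [← h1, getElem?_init_eq_some] at this
      exact this.2 ▸ hφ y n
    have key : ∀ k, init h (path h k).1.1.length = (path h k).1.1 := fun k => by
      obtain ⟨h', hh', j, ht⟩ := hbr (path h k).1.1.length
      have hle : (path h k).1.1.length ≤ (path h' j).1.1.length := by simpa using ht.length_le
      -- The branch `h` agrees up to `|path h k|` with a node on the path of `h'`. So `h` and `h'`
      -- give the same values at the splitting positions before step `k`.
      have agree : ∀ i ≤ k, path h i = path h' i := by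
        intro i
        induction i with
        | zero => exact fun _ => rfl
        | succ i ih =>
          intro hi
          have e := ih (Nat.le_of_succ_le hi)
          have hij : i < j := by
            by_contra! hji
            have h1 := (mono₁ hh' hji).length_le
            have h2 := len_lt hh hi
            rw [← e] at h1
            omega
          have h1 := getElem?_of_prefix ht (getElem?_init_eq_some.2 ⟨Nlt hh hi, rfl⟩)
          have h2 := getElem?_of_prefix (mono₁ hh' hij) (step hh' i).2.1
          rw [← e, h1, Option.some_inj] at h2
          rw [path_succ, path_succ, ← e]
          simp only [hF, h2]
      have e := agree k le_rfl
      have hkj : k ≤ j := by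
        by_contra! hjk
        have := len_lt hh' hjk
        rw [← e] at this
        omega
      have h1 : (path h k).1.1 <+: (path h' j).1.1 := e ▸ mono₁ hh' hkj
      exact (List.prefix_of_prefix_length_le ht h1 (by simp)).eq_of_length (by simp)
    -- Each positive piece along the path of `h` is nonempty and supplies some `z k` whose image
    -- extends the `k`-th node. The approximations cohere, so `z k` converges, and by continuity the
    -- image of the limit is `h`.
    choose y hy using fun k => nonempty_of_notMem_idealIE (path h k).2
    choose z hz hz₁ hz₂ using hy
    have hz₁' : ∀ i k, i < k → φ (z k) i = h i := fun i k hik => by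
      have hi : i < (path h k).1.1.length := hik.trans_le (le_len hh k)
      have h1 : (path h k).1.1[i]? = some (h i) := by
        rw [← key k]; exact getElem?_init_eq_some.2 ⟨hi, rfl⟩
      rw [← hz₁ k, getElem?_init_eq_some, ← hz k] at h1
      exact h1.2
    have hz₂' : ∀ i k, i < k → z k i = z (i + 1) i := fun i k hik => by
      have h1 : (path h (i + 1)).1.2[i]? = some (z (i + 1) i) := by
        rw [← hz₂ (i + 1)]
        exact getElem?_init_eq_some.2 ⟨by rw [len₂ hh]; omega, rfl⟩
      have h2 := getElem?_of_prefix (mono₂ hh hik) h1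
      rw [← hz₂ k, getElem?_init_eq_some] at h2
      exact h2.2
    have lim₂ : Tendsto z atTop (𝓝 fun i => z (i + 1) i) := tendsto_pi_nhds.2 fun i =>
      tendsto_const_nhds.congr' (eventually_atTop.2 ⟨i + 1, fun k hk => (hz₂' i k hk).symm⟩)
    have lim₁ : Tendsto (fun k => φ (z k)) atTop (𝓝 h) := tendsto_pi_nhds.2 fun i =>
      tendsto_const_nhds.congr' (eventually_atTop.2 ⟨i + 1, fun k hk => (hz₁' i k hk).symm⟩)
    exact ⟨_, tendsto_nhds_unique ((hφc.tendsto _).comp lim₂) lim₁⟩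

/-- A Borel set is analytic, so it is empty or a continuous image of Baire space. -/
theorem exists_thick_of_borel {A : Set (ℕ → ℕ)} (hA : A ⊆ prodSpace g)
    (hAm : @MeasurableSet _ (borel (ℕ → ℕ)) A) (hpos : A ∉ idealIE g) :
    ∃ T, IsThick g T ∧ branches T ⊆ A := by
  have hb : (MeasurableSpace.pi : MeasurableSpace (ℕ → ℕ)) = borel (ℕ → ℕ) :=
    BorelSpace.measurable_eq
  rw [← hb] at hAm
  have han := hAm.analyticSet
  rw [MeasureTheory.AnalyticSet] at han
  rcases han with rfl | ⟨φ, hφ, rfl⟩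
  · exact absurd (empty_mem_idealIE g) hpos
  · exact exists_thick_subset_range hφ (fun y => hA ⟨y, rfl⟩) hpos

end Analytic

/-! ### Thick trees are positive -/

variable {g : ℕ → ℕ} {T : Set (List ℕ)}

theorem IsThick.branches_subset (hT : IsThick g T) : branches T ⊆ prodSpace g := fun h hh n =>
  hT.dominated _ (hh (n + 1)) n (h n) (getElem?_init_eq_some.2 ⟨n.lt_succ_self, rfl⟩)

/-- Membership is a countable conjunction of conditions on finitely many coordinates, and any subset
of the countable space `Fin n → ℕ` is measurable. -/
theorem measurableSet_branches (T : Set (List ℕ)) :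
    @MeasurableSet _ (borel (ℕ → ℕ)) (branches T) := by
  have hb : (MeasurableSpace.pi : MeasurableSpace (ℕ → ℕ)) = borel (ℕ → ℕ) :=
    BorelSpace.measurable_eq
  rw [← hb]
  have : branches T = ⋂ n, (fun (h : ℕ → ℕ) (i : Fin n) => h i) ⁻¹' {s | List.ofFn s ∈ T} := by
    ext h
    simp [branches, List.ofFn_eq_map, ← List.map_coe_finRange_eq_range, Function.comp_def]
  rw [this]
  exact MeasurableSet.iInter fun n =>
    (measurable_pi_lambda _ fun i => measurable_pi_apply _) (Set.to_countable _).measurableSet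

/-- Given countably many `f k` whose sets `A_{f k}` cover `[T]`, thickness lets a branch agree with
each `f k` at arbitrarily late positions, a contradiction. -/
theorem IsThick.branches_notMem_idealIE (hg : ∀ n, 0 < g n) (hT : IsThick g T) :
    branches T ∉ idealIE g := by
  intro hmem
  obtain ⟨f, hf, hcov⟩ := exists_cover_of_mem_idealIE hg hmem
  have hstep : ∀ (t : T) (k : ℕ), ∃ s : T, t.1 <+: s.1 ∧
      ∃ n, t.1.length ≤ n ∧ s.1[n]? = some (f k n) := fun t k => by
    obtain ⟨n, hn, H⟩ := hT.thick t.1 t.2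
    obtain ⟨s, hs, hts, hsn⟩ := H (f k n) (hf k n)
    exact ⟨⟨s, hs⟩, hts, n, hn, hsn⟩
  choose next hpre pos hpos hval using hstep
  obtain ⟨t₀, ht₀⟩ := hT.nonempty
  -- The first component of unpairing takes each value `k` infinitely often, so each `f k` is
  -- treated at infinitely many stages.
  set p : ℕ → T := fun j => Nat.rec ⟨t₀, ht₀⟩ (fun j t => next t j.unpair.1) j with hp
  have mono : ∀ {i j}, i ≤ j → (p i).1 <+: (p j).1 :=
    prefix_of_le (p := fun j => (p j).1) fun _ => hpre _ _
  have le_len : ∀ j, j ≤ (p j).1.length := fun j => by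
    induction j with
    | zero => exact Nat.zero_le _
    | succ j ih =>
      have h1 := (List.getElem?_eq_some_iff.1 (hval (p j) j.unpair.1)).1
      exact (ih.trans (hpos (p j) j.unpair.1)).trans_lt h1
  -- The default `0` is never used, since `p (i + 1)` has length greater than `i`.
  set h : ℕ → ℕ := fun i => (p (i + 1)).1.getD i 0 with hh
  have hpi : ∀ j i m, (p j).1[i]? = some m → h i = m := fun j i m hi => by
    have h1 : i < (p (i + 1)).1.length := le_len (i + 1)
    have h2 : (p (i + 1)).1[i]? = some (h i) := by
      simp [hh, List.getD_eq_getElem?_getD, h1]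
    rcases le_total j (i + 1) with hj | hj
    · rw [getElem?_of_prefix (mono hj) hi] at h2
      exact (Option.some_inj.1 h2).symm
    · rw [getElem?_of_prefix (mono hj) h2] at hi
      exact Option.some_inj.1 hi
  have hbr : h ∈ branches T := fun n => by
    refine hT.tree _ (p n).2 _ ?_
    conv_rhs => rw [← eq_init_of_forall (hpi n)]
    exact init_prefix_init h (le_len n)
  obtain ⟨k, -, hk⟩ := mem_iUnion.1 (hcov hbr)
  obtain ⟨N, hN⟩ := hk.bddAbove
  -- Stage `Nat.pair k (N + 1)` treats `f k` at a position that is at least the stage number, hence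
  -- beyond the bound `N` on agreements.
  have hj : N + 1 ≤ Nat.pair k (N + 1) := Nat.right_le_pair _ _
  set j := Nat.pair k (N + 1) with hjdef
  have h1 := hval (p j) j.unpair.1
  have h2 := hpi (j + 1) _ _ h1
  have h3 := hpos (p j) j.unpair.1
  rw [hjdef, Nat.unpair_pair] at h2 h3
  have h4 := hN h2
  have h5 := le_len j
  rw [hjdef] at h5 hj
  omega

/-! ### Density -/

theorem mk_eq_zero_iff {B : BorelSubset g} :
    BorelMod.mk B = BorelMod.zero g ↔ B.1 ∈ idealIE g := by
  constructor
  · intro h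
    have h1 : B.1 \ ∅ ∈ idealIE g := (Quotient.exact h).1
    simpa using h1
  · intro h
    refine Quotient.sound ⟨?_, ?_⟩
    · change B.1 \ ∅ ∈ idealIE g
      simpa using h
    · change ∅ \ B.1 ∈ idealIE g
      simpa using empty_mem_idealIE g

theorem exists_thickClass_le {b : BorelMod g} (hb : b ≠ BorelMod.zero g) :
    ∃ q ∈ thickClasses g, q ≠ BorelMod.zero g ∧ q ≤ b := by
  obtain ⟨B, rfl⟩ : ∃ B, BorelMod.mk B = b := Quotient.exists_rep b
  rw [Ne, mk_eq_zero_iff] at hb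
  obtain ⟨T, hT, hTB⟩ := exists_thick_of_borel B.2.1 B.2.2 hb
  obtain ⟨h, hh⟩ := nonempty_of_notMem_idealIE hb
  -- A nonzero class has a nonempty representative, so the product is nonempty.
  have hg : ∀ n, 0 < g n := fun n => (Nat.zero_le _).trans_lt (B.2.1 hh n)
  refine ⟨BorelMod.mk ⟨branches T, hT.branches_subset, measurableSet_branches T⟩,
    ⟨T, hT, _, rfl, rfl⟩, ?_, ?_⟩
  · exact fun h => hT.branches_notMem_idealIE hg (mk_eq_zero_iff.1 h)
  · change branches T \ B.1 ∈ idealIE g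
    rw [sdiff_eq_empty.2 hTB]
    exact empty_mem_idealIE g

end ThickTree

/-! ### The three statements together -/

theorem lemma3p3p2 :
    -- every Borel positive set contains all branches of a thick tree
    (∀ g : ℕ → ℕ, ∀ A : Set (ℕ → ℕ), A ⊆ ThickTree.prodSpace g →
      @MeasurableSet _ (borel (ℕ → ℕ)) A → A ∉ ThickTree.idealIE g →
      ∃ T, ThickTree.IsThick g T ∧ ThickTree.branches T ⊆ A) ∧
    -- in ZF + AD, this holds for all positive sets
    (∀ (M : Type u) [Membership M M], SetModel.ModelsZF M → SetModel.ModelsAD M →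
      ∀ w g A : M, SetModel.IsOmega w → SetModel.IsFun g w w →
        (∀ h, h ∈ A → SetModel.InProd w g h) → ¬ SetModel.InIdealIE w g A →
        ∃ T, SetModel.IsThick w g T ∧ ∀ h, SetModel.IsBranch w T h → h ∈ A) ∧
    -- the thick trees are conditions in Borel(∏ g(n)) / I_ie(g) and form a dense set
    (∀ g : ℕ → ℕ,
      ((∀ n, 0 < g n) → ∀ T, ThickTree.IsThick g T →
        ∃ B : ThickTree.BorelSubset g, B.1 = ThickTree.branches T ∧
          ThickTree.BorelMod.mk B ≠ ThickTree.BorelMod.zero g) ∧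
      (∀ b : ThickTree.BorelMod g, b ≠ ThickTree.BorelMod.zero g →
        ∃ q ∈ ThickTree.thickClasses g, q ≠ ThickTree.BorelMod.zero g ∧ q ≤ b)) := by
  refine ⟨fun g A hA hAm hpos => ThickTree.exists_thick_of_borel hA hAm hpos, ?_, fun g =>
    ⟨fun hg T hT => ⟨⟨ThickTree.branches T, hT.branches_subset,
      ThickTree.measurableSet_branches T⟩, rfl, fun h =>
        hT.branches_notMem_idealIE hg (ThickTree.mk_eq_zero_iff.1 h)⟩,
      fun b hb => ThickTree.exists_thickClass_le hb⟩⟩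
  intro M _ hZF hAD w g A hw hg hA hpos
  have : SetModel.ZF M := ⟨hZF⟩
  obtain rfl := SetModel.isOmega_iff.1 hw
  exact SetModel.exists_thick_of_modelsAD hAD hg hA hpos
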